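/- Let $R$ be an associative ring with $1$ of finite stable range $r=\mathrm{sr}(R)$. Here $\mathrm{sr}(R)$ is the smallest integer $k\ge 1$ such that for every $m\ge k$ and all $a_1,\dots,a_{m+1}\in R$ with $Ra_1+\dots+Ra_{m+1}=R$ there are $t_1,\dots,t_m\in R$ with $R(a_1+t_1a_{m+1})+\dots+R(a_m+t_ma_{m+1})=R$. For a ring $A$ with $1$, an elementary matrix in $GL_m(A)$ is a matrix $e_{ij}(a)$ with $i\ne j$ and $a\in A$, having $1$ along the diagonal, $a$ in position $(i,j)$ and $0$ elsewhere; $EL_m(A)\le GL_m(A)$ is the subgroup generated by the elementary matrices. Identify $M_4(M_n(R))$ with $M_{4n}(R)$ by erasing the block lines, so that the elementary matrices of $EL_4(M_n(R))$ are regarded as elements of $GL_{4n}(R)$, and for $d\le 4n$ regard $EL_d(R)$ as a subgroup of $GL_{4n}(R)$ through the upper left corner embedding $S\mapsto \begin{pmatrix} S&0\\0&I_{4n-d}\end{pmatrix}$. Then for all integers $n\ge d>r$, every $g\in EL_{4n}(R)$ can be written as $$g=g_1g_2\cdots g_k\,s,\qquad k\le 340,$$ where $g_1,\dots,g_k$ are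 elementary matrices of $EL_4(M_n(R))$ and $s\in EL_d(R)$. -/

import Mathlib

/-- The elementary matrix `e_{ij}(r)`: ones on the diagonal, `r` in position `(i, j)`, zero
elsewhere, as an element of the general linear group `(Matrix ι ι R)ˣ`. -/
def elementaryGL {ι R : Type*} [Fintype ι] [DecidableEq ι] [Ring R]
    (i j : ι) (hij : i ≠ j) (r : R) : (Matrix ι ι R)ˣ where
  val := 1 + Matrix.single i j r
  inv := 1 + Matrix.single i j (-r)
  val_inv := by
    have h : Matrix.single i j r * Matrix.single i j (-r) = 0 :=
      Matrix.single_mul_single_of_ne r i j i hij.symm (-r)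
    have h' : Matrix.single i j r + Matrix.single i j (-r) = 0 := by
      rw [← Matrix.single_add, add_neg_cancel, Matrix.single_zero]
    rw [mul_add, add_mul, add_mul, h]
    simp only [one_mul, mul_one, add_zero]
    rw [add_assoc, h', add_zero]
  inv_val := by
    have h : Matrix.single i j (-r) * Matrix.single i j r = 0 :=
      Matrix.single_mul_single_of_ne (-r) i j i hij.symm r
    have h' : Matrix.single i j (-r) + Matrix.single i j r = 0 := by
      rw [← Matrix.single_add, neg_add_cancel, Matrix.single_zero]
    rw [mul_add, add_mul, add_mul, h]
    simp only [one_mul, mul_one, add_zero]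
    rw [add_assoc, h', add_zero]

/-- The set of elementary matrices in the general linear group of `ι × ι` matrices over `R`. -/
def elementaryMatrices (ι R : Type*) [Fintype ι] [DecidableEq ι] [Ring R] :
    Set (Matrix ι ι R)ˣ :=
  {g | ∃ (i j : ι) (hij : i ≠ j) (r : R), g = elementaryGL i j hij r}

/-- The elementary group `EL_m(R)`, the subgroup of `GL_m(R)` generated by the elementary
matrices. -/
def EL (m : ℕ) (R : Type*) [Ring R] : Subgroup (Matrix (Fin m) (Fin m) R)ˣ :=
  Subgroup.closure (elementaryMatrices (Fin m) R)

/-- A finite sequence is left unimodular if `R a₁ + ⋯ + R aₘ = R` (over a noncommutative ring,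
`Ideal` is the type of left ideals). -/
def IsLeftUnimodular {R : Type*} [Ring R] {m : ℕ} (a : Fin m → R) : Prop :=
  Ideal.span (Set.range a) = ⊤

/-- A sequence `a₁, …, aₘ₊₁` is reducible if there are `t₁, …, tₘ` such that
`a₁ + t₁ aₘ₊₁, …, aₘ + tₘ aₘ₊₁` is left unimodular. -/
def IsLeftReducible {R : Type*} [Ring R] {m : ℕ} (a : Fin (m + 1) → R) : Prop :=
  ∃ t : Fin m → R, IsLeftUnimodular fun i : Fin m => a i.castSucc + t i * a (Fin.last m)

/-- `R` has left stable range at most `k`: every left unimodular sequence of length `m + 1 > k`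
is reducible. -/
def LeftStableRangeLE (R : Type*) [Ring R] (k : ℕ) : Prop :=
  ∀ m : ℕ, k < m + 1 → ∀ a : Fin (m + 1) → R, IsLeftUnimodular a → IsLeftReducible a

/-- The stable range of `R`: the smallest positive integer `k` such that `R` has left stable range
at most `k`, and `⊤` if there is none. (Reducibility concerns sequences of length at least two,
hence `1 ≤ k`.) -/
noncomputable def stableRange (R : Type*) [Ring R] : ℕ∞ :=
  ⨅ (k : ℕ) (_ : 1 ≤ k ∧ LeftStableRangeLE R k), (k : ℕ∞)

/-- The ring isomorphism `M_b(M_n(R)) ≃ M_{bn}(R)` that erases the block lines: the entry `(k, l)`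
of the block `(i, j)` becomes the entry `(n i + k, n j + l)` (indices starting at `0`). -/
def blockEquiv (b n : ℕ) (R : Type*) [Ring R] :
    Matrix (Fin b) (Fin b) (Matrix (Fin n) (Fin n) R) ≃+*
      Matrix (Fin (b * n)) (Fin (b * n)) R :=
  (Matrix.compRingEquiv (Fin b) (Fin n) R).trans (Matrix.reindexRingEquiv R finProdFinEquiv)

/-- The upper left corner embedding `S ↦ diag(S, I_{N-d})` of `d × d` matrices into `N × N`
matrices. -/
def cornerEmbed {R : Type*} [Ring R] {d N : ℕ} (h : d ≤ N) (S : Matrix (Fin d) (Fin d) R) :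
    Matrix (Fin N) (Fin N) R :=
  Matrix.reindex (finSumFinEquiv.trans (finCongr (Nat.add_sub_of_le h)))
    (finSumFinEquiv.trans (finCongr (Nat.add_sub_of_le h)))
    (Matrix.fromBlocks S 0 0 (1 : Matrix (Fin (N - d)) (Fin (N - d)) R))

/-!
Write `U(t) = [1, t; 0, 1]`, `L(w) = [1, 0; w, 1]` and `D(s) = diag(s, 1)` for matrices with one row
and column split off at the end.

**Reduction to unitriangular matrices.** If the stable range is at most `m`, every
`g ∈ GL_{m+1}(R)` is a product `U(t) L(w) U(v) L(z) D(g')` with `g' ∈ GL_m(R)`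
(`exists_eq_mul_cornerGL`). Since `D(g')` normalizes the groups of all `U(t)` and of all `L(w)`,
these factorizations for `m = d, …, N - 1` can be merged: `g ∈ GL_N(R)` is the product of four
matrices, alternately upper and lower unitriangular, and of `diag(s, 1)` with `s ∈ GL_d(R)`
(`exists_eq_mul_iterStabGL`).

**The corner is elementary.** Unitriangular matrices are elementary, so for `g ∈ EL_N(R)` also
`diag(s, 1) ∈ EL_N(R)`, and `s ∈ EL_d(R)` by injective stability for `K₁`, proved here for
`d > r` (`mem_elementaryGroup_of_cornerGL_mem`): the products `U(t) L(w) U(v) L(z) D(s)` with `v`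
unimodular and `s` elementary form a set `bigCell` closed under left multiplication by elementary
matrices. The point is that, modulo the `L(z) D(s)` on the right, the factor `U(t)` can be altered
as long as the upper part of the last column remains unimodular
(`exists_upperGL_mul_lowerGL_mul_upperGL_eq`).

**Unitriangular matrices have bounded width.** An upper unitriangular matrix with superdiagonal
entries `1` is similar to the Jordan block `J`. Hence an upper unitriangular `T ∈ GL_n(R)` is a
product of a commutator `X J X⁻¹ J⁻¹` and of two matrices `1 + x y` with `y x = 0`, which take care
of its superdiagonal (`UpperUni.isShort`). In `GL_4(M_n(R))`, putting a commutator on the diagonal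
takes at most `8` elementary matrices by Whitehead's lemma, and `1 + x y` with `y x = 0` takes `4`.
So a unitriangular matrix of size `4 n` is a product of `6 + 4 · (8 + 4 + 4) = 70` elementary block
matrices, and the four factors of `g` need at most `280 ≤ 340` of them.
-/

set_option linter.unusedSectionVars false

namespace BlockElementary

open Matrix

/-! ### Block unipotent matrices -/

section Blocks

variable {ι τ R : Type*} [Fintype ι] [DecidableEq ι] [Fintype τ] [DecidableEq τ] [Ring R]

/-- The block unipotent matrix `[1, t; 0, 1]`. -/
def upperGL (t : Matrix ι τ R) : (Matrix (ι ⊕ τ) (ι ⊕ τ) R)ˣ where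
  val := fromBlocks 1 t 0 1
  inv := fromBlocks 1 (-t) 0 1
  val_inv := by simp [fromBlocks_multiply]
  inv_val := by simp [fromBlocks_multiply]

/-- The block unipotent matrix `[1, 0; w, 1]`. -/
def lowerGL (w : Matrix τ ι R) : (Matrix (ι ⊕ τ) (ι ⊕ τ) R)ˣ where
  val := fromBlocks 1 0 w 1
  inv := fromBlocks 1 0 (-w) 1
  val_inv := by simp [fromBlocks_multiply]
  inv_val := by simp [fromBlocks_multiply]

/-- The stabilization `s ↦ [s, 0; 0, 1]`. -/
def cornerGL (τ : Type*) [Fintype τ] [DecidableEq τ] :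
    (Matrix ι ι R)ˣ →* (Matrix (ι ⊕ τ) (ι ⊕ τ) R)ˣ where
  toFun s :=
    { val := fromBlocks s.val 0 0 1
      inv := fromBlocks s.inv 0 0 1
      val_inv := by simp [fromBlocks_multiply]
      inv_val := by simp [fromBlocks_multiply] }
  map_one' := by ext1; simp
  map_mul' s t := by ext1; simp [fromBlocks_multiply]

/-- The unipotent matrix `1 + x y`, where `y x = 0`. -/
def oneAddGL (x : Matrix ι τ R) (y : Matrix τ ι R) (h : y * x = 0) : (Matrix ι ι R)ˣ where
  val := 1 + x * y
  inv := 1 - x * y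
  val_inv := by
    have : x * y * (x * y) = 0 := by
      rw [Matrix.mul_assoc, ← Matrix.mul_assoc y, h, Matrix.zero_mul, Matrix.mul_zero]
    simp [mul_sub, add_mul, this]
  inv_val := by
    have : x * y * (x * y) = 0 := by
      rw [Matrix.mul_assoc, ← Matrix.mul_assoc y, h, Matrix.zero_mul, Matrix.mul_zero]
    simp [sub_mul, mul_add, this]

theorem val_upperGL (t : Matrix ι τ R) : (upperGL t).val = fromBlocks 1 t 0 1 := rfl

theorem val_lowerGL (w : Matrix τ ι R) : (lowerGL w).val = fromBlocks 1 0 w 1 := rfl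

theorem val_cornerGL (s : (Matrix ι ι R)ˣ) : (cornerGL τ s).val = fromBlocks s.val 0 0 1 := rfl

theorem val_oneAddGL (x : Matrix ι τ R) (y : Matrix τ ι R) (h : y * x = 0) :
    (oneAddGL x y h).val = 1 + x * y := rfl

theorem upperGL_mul (s t : Matrix ι τ R) : upperGL s * upperGL t = upperGL (s + t) := by
  ext1; simp [val_upperGL, fromBlocks_multiply, add_comm]

theorem lowerGL_mul (s t : Matrix τ ι R) : lowerGL s * lowerGL t = lowerGL (s + t) := by
  ext1; simp [val_lowerGL, fromBlocks_multiply]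

theorem upperGL_zero : upperGL (0 : Matrix ι τ R) = 1 := by
  ext1; simp [val_upperGL]

theorem lowerGL_zero : lowerGL (0 : Matrix τ ι R) = 1 := by
  ext1; simp [val_lowerGL]

theorem upperGL_inv (t : Matrix ι τ R) : (upperGL t)⁻¹ = upperGL (-t) := by
  rw [inv_eq_iff_mul_eq_one, upperGL_mul, add_neg_cancel, upperGL_zero]

theorem lowerGL_inv (t : Matrix τ ι R) : (lowerGL t)⁻¹ = lowerGL (-t) := by
  rw [inv_eq_iff_mul_eq_one, lowerGL_mul, add_neg_cancel, lowerGL_zero]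

theorem cornerGL_mul_upperGL (s : (Matrix ι ι R)ˣ) (t : Matrix ι τ R) :
    cornerGL τ s * upperGL t = upperGL (s.val * t) * cornerGL τ s := by
  ext1; simp [val_upperGL, val_cornerGL, fromBlocks_multiply]

theorem cornerGL_mul_lowerGL (s : (Matrix ι ι R)ˣ) (w : Matrix τ ι R) :
    cornerGL τ s * lowerGL w = lowerGL (w * s⁻¹.val) * cornerGL τ s := by
  ext1; simp [val_lowerGL, val_cornerGL, fromBlocks_multiply, Matrix.mul_assoc]

theorem lowerGL_mul_cornerGL (s : (Matrix ι ι R)ˣ) (w : Matrix τ ι R) :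
    lowerGL w * cornerGL τ s = cornerGL τ s * lowerGL (w * s.val) := by
  ext1; simp [val_lowerGL, val_cornerGL, fromBlocks_multiply]

theorem upperGL_mul_cornerGL (s : (Matrix ι ι R)ˣ) (t : Matrix ι τ R) :
    upperGL t * cornerGL τ s = cornerGL τ s * upperGL (s⁻¹.val * t) := by
  ext1; simp [val_upperGL, val_cornerGL, fromBlocks_multiply, ← Matrix.mul_assoc]

/-- Changing the left upper factor of `U(t) L(w) U(v)` by a column killed by `w`. -/
theorem upperGL_mul_lowerGL_mul_upperGL (t v : Matrix ι τ R) (w : Matrix τ ι R) (h : w * t = 0) :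
    upperGL t * lowerGL w * upperGL v =
      lowerGL w * upperGL (v + t * (1 + w * v)) * cornerGL τ (oneAddGL t w h) := by
  have h' : ∀ z : Matrix τ ι R, w * (t * z) = 0 := fun z => by
    rw [← Matrix.mul_assoc, h, Matrix.zero_mul]
  have h'' : ∀ z : Matrix τ τ R, w * (t * z) = 0 := fun z => by
    rw [← Matrix.mul_assoc, h, Matrix.zero_mul]
  ext1
  simp only [val_upperGL, val_lowerGL, val_cornerGL, val_oneAddGL, fromBlocks_multiply,
    Units.val_mul, Matrix.mul_add, Matrix.add_mul, Matrix.mul_one, Matrix.one_mul, Matrix.mul_zero,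
    add_zero, zero_add, Matrix.mul_assoc, h, h', h'']
  congr 1
  abel

/-- Changing the factor `L(w)` of `L(w) U(v)` by a row that kills `v`. -/
theorem lowerGL_mul_upperGL (v : Matrix ι τ R) (z : Matrix τ ι R) (h : z * v = 0) :
    lowerGL z * upperGL v = upperGL v * cornerGL τ (oneAddGL v (-z) (by simp [h])) * lowerGL z := by
  ext1
  simp [val_upperGL, val_lowerGL, val_cornerGL, val_oneAddGL, fromBlocks_multiply, h]

/-- Conjugating a lower block unipotent matrix by `U(t)` with `f t = 0`. -/
theorem lowerGL_mul_upperGL_neg (t : Matrix ι τ R) (f : Matrix τ ι R) (h : f * t = 0) :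
    lowerGL f * upperGL (-t) =
      upperGL (-t) * lowerGL f * cornerGL τ (oneAddGL t f h) := by
  have h' : ∀ y : Matrix τ ι R, f * (t * y) = 0 := fun y => by
    rw [← Matrix.mul_assoc, h, Matrix.zero_mul]
  ext1
  simp [val_upperGL, val_lowerGL, val_cornerGL, val_oneAddGL, fromBlocks_multiply, h,
    Matrix.mul_add, Matrix.add_mul, Matrix.mul_assoc, h']

end Blocks

/-! ### The elementary group of a finite index type -/

section Elementary

variable {ι κ τ R : Type*} [Fintype ι] [DecidableEq ι] [Fintype κ] [DecidableEq κ]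
  [Fintype τ] [DecidableEq τ] [Ring R]

/-- The elementary group, for matrices indexed by an arbitrary finite type. -/
def elementaryGroup (ι R : Type*) [Fintype ι] [DecidableEq ι] [Ring R] :
    Subgroup (Matrix ι ι R)ˣ :=
  Subgroup.closure (elementaryMatrices ι R)

theorem elementaryGL_mem {i j : ι} (hij : i ≠ j) (a : R) :
    elementaryGL i j hij a ∈ elementaryGroup ι R :=
  Subgroup.subset_closure ⟨i, j, hij, a, rfl⟩

theorem elementaryGL_inv {i j : ι} (hij : i ≠ j) (a : R) :
    (elementaryGL i j hij a)⁻¹ = elementaryGL i j hij (-a) := by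
  ext1; rfl

theorem upperGL_single (i : ι) (j : τ) (a : R) :
    upperGL (Matrix.single i j a) = elementaryGL (Sum.inl i) (Sum.inr j) (by simp) a := by
  ext1
  ext x y
  rcases x with x | x <;> rcases y with y | y <;>
    simp [val_upperGL, elementaryGL, Matrix.single_apply, Matrix.one_apply]

theorem lowerGL_single (i : τ) (j : ι) (a : R) :
    lowerGL (Matrix.single i j a) = elementaryGL (Sum.inr i) (Sum.inl j) (by simp) a := by
  ext1
  ext x y
  rcases x with x | x <;> rcases y with y | y <;>
    simp [val_lowerGL, elementaryGL, Matrix.single_apply, Matrix.one_apply]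

theorem cornerGL_elementaryGL {i j : ι} (hij : i ≠ j) (a : R) :
    cornerGL τ (elementaryGL i j hij a) =
      elementaryGL (Sum.inl i) (Sum.inl j) (Sum.inl_injective.ne hij) a := by
  ext1
  ext x y
  rcases x with x | x <;> rcases y with y | y <;>
    simp [val_cornerGL, elementaryGL, Matrix.single_apply, Matrix.one_apply]

theorem upperGL_mem (t : Matrix ι τ R) : upperGL t ∈ elementaryGroup (ι ⊕ τ) R := by
  induction t using Matrix.induction_on' with
  | h_zero => rw [upperGL_zero]; exact one_mem _
  | h_add p q hp hq => rw [← upperGL_mul]; exact mul_mem hp hq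
  | h_std_basis i j x => rw [upperGL_single]; exact elementaryGL_mem _ _

theorem lowerGL_mem (t : Matrix τ ι R) : lowerGL t ∈ elementaryGroup (ι ⊕ τ) R := by
  induction t using Matrix.induction_on' with
  | h_zero => rw [lowerGL_zero]; exact one_mem _
  | h_add p q hp hq => rw [← lowerGL_mul]; exact mul_mem hp hq
  | h_std_basis i j x => rw [lowerGL_single]; exact elementaryGL_mem _ _

theorem cornerGL_mem {s : (Matrix ι ι R)ˣ} (hs : s ∈ elementaryGroup ι R) :
    cornerGL τ s ∈ elementaryGroup (ι ⊕ τ) R := by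
  have : elementaryGroup ι R ≤ (elementaryGroup (ι ⊕ τ) R).comap (cornerGL τ) := by
    refine (Subgroup.closure_le _).2 ?_
    rintro _ ⟨i, j, hij, a, rfl⟩
    simp only [Subgroup.coe_comap, Set.mem_preimage, SetLike.mem_coe, cornerGL_elementaryGL]
    exact elementaryGL_mem _ _
  exact this hs

end Elementary

/-! ### Unimodular columns and the stable range condition -/

section StableRange

variable {ι κ R : Type*} [Fintype ι] [DecidableEq ι] [Fintype κ] [DecidableEq κ] [Ring R]

/-- A column is unimodular if it has a left inverse. -/
def Unimodular (v : Matrix ι (Fin 1) R) : Prop := ∃ p : Matrix (Fin 1) ι R, p * v = 1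

/-- The stable range condition for columns with one entry more than `κ`: a unimodular column
`(x, a)` can be shortened to a unimodular column `x + t a`. The entry `a` and the coefficient `q`
are written as `1 × 1` matrices. -/
def StableFor (κ R : Type*) [Fintype κ] [Ring R] : Prop :=
  ∀ (x : Matrix κ (Fin 1) R) (a : Matrix (Fin 1) (Fin 1) R)
    (p : Matrix (Fin 1) κ R) (q : Matrix (Fin 1) (Fin 1) R), p * x + q * a = 1 →
      ∃ t : Matrix κ (Fin 1) R, Unimodular (x + t * a)

theorem Unimodular.unit_mul {v : Matrix ι (Fin 1) R} (hv : Unimodular v) (s : (Matrix ι ι R)ˣ) :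
    Unimodular (s.val * v) := by
  obtain ⟨p, hp⟩ := hv
  refine ⟨p * s⁻¹.val, ?_⟩
  rw [Matrix.mul_assoc, ← Matrix.mul_assoc _ s.val, Units.inv_mul, Matrix.one_mul, hp]

/-- The last standard basis column. -/
def lastCol (κ R : Type*) [Ring R] : Matrix (κ ⊕ Fin 1) (Fin 1) R := fromRows 0 1

theorem unimodular_lastCol : Unimodular (lastCol κ R) :=
  ⟨fromCols 0 1, by simp [lastCol, fromCols_mul_fromRows]⟩

theorem upperGL_mul_fromRows (t x : Matrix κ (Fin 1) R) (a : Matrix (Fin 1) (Fin 1) R) :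
    (upperGL t).val * fromRows x a = fromRows (x + t * a) a := by
  simp [val_upperGL, fromBlocks_mul_fromRows]

theorem lowerGL_mul_fromRows (t : Matrix (Fin 1) κ R) (x : Matrix κ (Fin 1) R)
    (a : Matrix (Fin 1) (Fin 1) R) :
    (lowerGL t).val * fromRows x a = fromRows x (t * x + a) := by
  simp [val_lowerGL, fromBlocks_mul_fromRows]

/-- The elementary group moves every unimodular column to the last basis column. -/
theorem exists_mul_eq_lastCol (hκ : StableFor κ R) {v : Matrix (κ ⊕ Fin 1) (Fin 1) R}
    (hv : Unimodular v) : ∃ s ∈ elementaryGroup (κ ⊕ Fin 1) R, s.val * v = lastCol κ R := by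
  obtain ⟨p, hp⟩ := hv
  obtain ⟨x, a, rfl⟩ : ∃ x a, v = fromRows x a := ⟨_, _, (fromRows_toRows v).symm⟩
  obtain ⟨p, q, rfl⟩ : ∃ x a, p = fromCols x a := ⟨_, _, (fromCols_toCols p).symm⟩
  rw [fromCols_mul_fromRows] at hp
  obtain ⟨t, e, he⟩ := hκ x a p q hp
  refine ⟨upperGL (-(x + t * a)) * lowerGL ((1 - a) * e) * upperGL t,
    mul_mem (mul_mem (upperGL_mem _) (lowerGL_mem _)) (upperGL_mem _), ?_⟩
  simp only [Units.val_mul, Matrix.mul_assoc, upperGL_mul_fromRows, lowerGL_mul_fromRows, he]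
  simp [lastCol]

/-- A transvection along a unimodular column is elementary. -/
theorem oneAddGL_mem (hκ : StableFor κ R) {v : Matrix (κ ⊕ Fin 1) (Fin 1) R} (hv : Unimodular v)
    (z : Matrix (Fin 1) (κ ⊕ Fin 1) R) (h : z * v = 0) :
    oneAddGL v z h ∈ elementaryGroup (κ ⊕ Fin 1) R := by
  obtain ⟨s, hs, hsv⟩ := exists_mul_eq_lastCol hκ hv
  obtain ⟨y, a, hya⟩ : ∃ y a, z * s⁻¹.val = fromCols y a := ⟨_, _, (fromCols_toCols _).symm⟩
  have ha : a = 0 := by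
    have : z * s⁻¹.val * lastCol κ R = 0 := by
      rw [← hsv, Matrix.mul_assoc, ← Matrix.mul_assoc _ s.val, Units.inv_mul, Matrix.one_mul, h]
    simpa [hya, lastCol, fromCols_mul_fromRows] using this
  have key : s * oneAddGL v z h * s⁻¹ = lowerGL y := by
    ext1
    have : s.val * (v * z) * s⁻¹.val = (s.val * v) * (z * s⁻¹.val) := by
      simp only [Matrix.mul_assoc]
    rw [Units.val_mul, Units.val_mul, val_oneAddGL, Matrix.mul_add, Matrix.add_mul, this, hsv, hya,
      ha, Matrix.mul_one, Units.mul_inv, val_lowerGL, lastCol, fromRows_mul, ← fromBlocks_one]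
    ext i j
    rcases i with i | i <;> rcases j with j | j <;> simp [Matrix.one_apply]
  have : oneAddGL v z h = s⁻¹ * lowerGL y * s := by rw [← key]; group
  rw [this]
  exact mul_mem (mul_mem (inv_mem hs) (lowerGL_mem _)) hs

/-- A transvection `1 + (u, 0) (0, w)` is elementary. -/
theorem oneAddGL_mem_of_fromRows_fromCols (u : Matrix κ (Fin 1) R) (a : Matrix (Fin 1) (Fin 1) R)
    (h : fromCols (0 : Matrix (Fin 1) κ R) a * fromRows u 0 = 0) :
    oneAddGL (fromRows u 0) (fromCols 0 a) h ∈ elementaryGroup (κ ⊕ Fin 1) R := by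
  have : oneAddGL (fromRows u 0) (fromCols 0 a) h = upperGL (u * a) := by
    ext1
    rw [val_oneAddGL, val_upperGL, fromRows_mul, mul_fromCols, ← fromBlocks_one]
    ext i j
    rcases i with i | i <;> rcases j with j | j <;> simp [Matrix.one_apply]
  rw [this]
  exact upperGL_mem _

end StableRange

/-! ### Injective stability -/

section InjectiveStability

variable {κ ι R : Type*} [Fintype κ] [DecidableEq κ] [Fintype ι] [DecidableEq ι] [Ring R]

/-- The group of matrices `[s, 0; z, 1]` with `s` in the elementary group. -/
def lowerAffine (ι R : Type*) [Fintype ι] [DecidableEq ι] [Ring R] :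
    Subgroup (Matrix (ι ⊕ Fin 1) (ι ⊕ Fin 1) R)ˣ where
  carrier := {g | ∃ (z : Matrix (Fin 1) ι R), ∃ s ∈ elementaryGroup ι R,
    g = lowerGL z * cornerGL (Fin 1) s}
  one_mem' := ⟨0, 1, one_mem _, by simp [lowerGL_zero]⟩
  mul_mem' := by
    rintro _ _ ⟨z, s, hs, rfl⟩ ⟨z', s', hs', rfl⟩
    refine ⟨z + z' * s⁻¹.val, s * s', mul_mem hs hs', ?_⟩
    rw [← lowerGL_mul, map_mul, mul_assoc, ← mul_assoc (cornerGL _ s), cornerGL_mul_lowerGL]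
    simp only [mul_assoc]
  inv_mem' := by
    rintro _ ⟨z, s, hs, rfl⟩
    refine ⟨-z * s.val, s⁻¹, inv_mem hs, ?_⟩
    rw [_root_.mul_inv_rev, lowerGL_inv, ← map_inv, cornerGL_mul_lowerGL, inv_inv]

theorem lowerGL_mem_lowerAffine (z : Matrix (Fin 1) ι R) : lowerGL z ∈ lowerAffine ι R :=
  ⟨z, 1, one_mem _, by simp⟩

theorem cornerGL_mem_lowerAffine {s : (Matrix ι ι R)ˣ} (hs : s ∈ elementaryGroup ι R) :
    cornerGL (Fin 1) s ∈ lowerAffine ι R :=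
  ⟨0, s, hs, by simp [lowerGL_zero]⟩

/-- Modulo `lowerAffine`, the product `L(w) U(v)` depends on `w` only through `w v`. -/
theorem exists_lowerGL_mul_upperGL_eq (hκ : StableFor κ R) {v : Matrix (κ ⊕ Fin 1) (Fin 1) R}
    (hv : Unimodular v) {w w' : Matrix (Fin 1) (κ ⊕ Fin 1) R} (h : w * v = w' * v) :
    ∃ p ∈ lowerAffine (κ ⊕ Fin 1) R, lowerGL w * upperGL v = lowerGL w' * upperGL v * p := by
  have hz : (w - w') * v = 0 := by rw [Matrix.sub_mul, h, sub_self]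
  refine ⟨_, mul_mem (cornerGL_mem_lowerAffine (oneAddGL_mem hκ hv (-(w - w'))
    (by rw [Matrix.neg_mul, hz, neg_zero]))) (lowerGL_mem_lowerAffine (w - w')), ?_⟩
  rw [mul_assoc, ← mul_assoc (upperGL v), ← lowerGL_mul_upperGL v _ hz, ← mul_assoc, lowerGL_mul,
    add_sub_cancel]

/-- The case of `exists_upperGL_mul_lowerGL_mul_upperGL_eq` in which `v` is a basis column. The
column `t` is reached through an intermediate column `u`, such that both `u` and `t - u` are killed
by rows with the prescribed product with the columns that they are added to. -/
theorem exists_upperGL_mul_lowerGL_mul_upperGL_lastCol_eq (hκ : StableFor κ R)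
    (t : Matrix (κ ⊕ Fin 1) (Fin 1) R) (w w' : Matrix (Fin 1) (κ ⊕ Fin 1) R)
    (hv' : Unimodular (lastCol κ R + t * (1 + w * lastCol κ R)))
    (hw' : w' * (lastCol κ R + t * (1 + w * lastCol κ R)) = w * lastCol κ R) :
    ∃ p ∈ lowerAffine (κ ⊕ Fin 1) R, upperGL t * lowerGL w * upperGL (lastCol κ R) =
      lowerGL w' * upperGL (lastCol κ R + t * (1 + w * lastCol κ R)) * p := by
  obtain ⟨t₀, t₁, rfl⟩ : ∃ x a, t = fromRows x a := ⟨_, _, (fromRows_toRows _).symm⟩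
  generalize hb : w * lastCol κ R = b at *
  have hvb : lastCol κ R + fromRows t₀ t₁ * (1 + b) =
      fromRows (t₀ * (1 + b)) (1 + t₁ * (1 + b)) := by
    rw [fromRows_mul, lastCol]
    ext i j
    rcases i with i | i <;> simp
  obtain ⟨y, q, hq⟩ : ∃ y : Matrix κ (Fin 1) R,
      Unimodular (t₀ * (1 + b) + y * (1 + t₁ * (1 + b))) := by
    obtain ⟨p, hp⟩ := hv'
    obtain ⟨p, c, rfl⟩ : ∃ x a, p = fromCols x a := ⟨_, _, (fromCols_toCols _).symm⟩
    rw [hvb, fromCols_mul_fromRows] at hp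
    exact hκ _ _ _ _ hp
  -- Both `w₀` and `w₁` take the value `b` on the columns that matter; `w₀ u = 0`, and the column
  -- `u` is chosen so that `t - u` is a multiple of the kernel element `(-y, 1)` of `w₁`.
  set v := lastCol κ R with hv
  set w₀ : Matrix (Fin 1) (κ ⊕ Fin 1) R := fromCols 0 b with hw₀
  set u : Matrix (κ ⊕ Fin 1) (Fin 1) R := fromRows (t₀ + y * t₁) 0 with hu
  set w₁ : Matrix (Fin 1) (κ ⊕ Fin 1) R := fromCols (b * q) (b * q * y) with hw₁
  have hw₀v : w₀ * v = b := by simp [hw₀, hv, lastCol, fromCols_mul_fromRows]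
  have hw₀u : w₀ * u = 0 := by simp [hw₀, hu, fromCols_mul_fromRows]
  have htu : fromRows t₀ t₁ - u = fromRows (-y) 1 * t₁ := by
    rw [hu, fromRows_mul]
    ext i j
    rcases i with i | i <;> simp
  have hw₁y : w₁ * fromRows (-y) (1 : Matrix (Fin 1) (Fin 1) R) = 0 := by
    simp [hw₁, fromCols_mul_fromRows]
  have hw₁tu : w₁ * (fromRows t₀ t₁ - u) = 0 := by
    rw [htu, ← Matrix.mul_assoc, hw₁y, Matrix.zero_mul]
  have hw₁v' : w₁ * (v + fromRows t₀ t₁ * (1 + b)) = b := by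
    rw [hvb, hw₁, fromCols_mul_fromRows, Matrix.mul_assoc, Matrix.mul_assoc, Matrix.mul_assoc,
      ← Matrix.mul_add, ← Matrix.mul_add, hq, Matrix.mul_one]
  have hw₁v : w₁ * (v + u * (1 + b)) = b := by
    have : v + u * (1 + b) = v + fromRows t₀ t₁ * (1 + b) - (fromRows t₀ t₁ - u) * (1 + b) := by
      rw [Matrix.sub_mul]; abel
    rw [this, Matrix.mul_sub, hw₁v', ← Matrix.mul_assoc, hw₁tu, Matrix.zero_mul, sub_zero]
  have hvu : Unimodular (v + u * (1 + b)) :=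
    ⟨fromCols 0 1, by simp [hv, hu, lastCol, fromRows_mul, Matrix.mul_add, fromCols_mul_fromRows]⟩
  have hy : Unimodular (fromRows (-y) (1 : Matrix (Fin 1) (Fin 1) R)) :=
    ⟨fromCols 0 1, by simp [fromCols_mul_fromRows]⟩
  -- First `w` is replaced by `w₀`, which kills `u`, and `u` is added.
  obtain ⟨p₁, hp₁, e₁⟩ := exists_lowerGL_mul_upperGL_eq hκ (hv ▸ unimodular_lastCol)
    (hb.trans hw₀v.symm)
  have e₂ := upperGL_mul_lowerGL_mul_upperGL u v w₀ hw₀u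
  have hp₂ : cornerGL (Fin 1) (oneAddGL u w₀ hw₀u) ∈ lowerAffine (κ ⊕ Fin 1) R :=
    cornerGL_mem_lowerAffine (oneAddGL_mem_of_fromRows_fromCols _ _ hw₀u)
  -- Then `w₀` is replaced by `w₁`, which kills `t - u`, and `t - u` is added.
  obtain ⟨p₃, hp₃, e₃⟩ := exists_lowerGL_mul_upperGL_eq hκ hvu (w := w₀) (w' := w₁) (by
    rw [hw₁v, Matrix.mul_add, hw₀v, ← Matrix.mul_assoc, hw₀u, Matrix.zero_mul, add_zero])
  have e₄ := upperGL_mul_lowerGL_mul_upperGL (fromRows t₀ t₁ - u) (v + u * (1 + b)) w₁ hw₁tu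
  have hp₄ : cornerGL (Fin 1) (oneAddGL (fromRows t₀ t₁ - u) w₁ hw₁tu) ∈
      lowerAffine (κ ⊕ Fin 1) R := by
    refine cornerGL_mem_lowerAffine ?_
    convert oneAddGL_mem hκ hy (t₁ * w₁) (by rw [Matrix.mul_assoc, hw₁y, Matrix.mul_zero]) using 1
    ext1
    rw [val_oneAddGL, val_oneAddGL, htu, Matrix.mul_assoc]
  have hsum : v + u * (1 + b) + (fromRows t₀ t₁ - u) * (1 + w₁ * (v + u * (1 + b))) =
      v + fromRows t₀ t₁ * (1 + b) := by
    rw [hw₁v, Matrix.sub_mul]; abel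
  rw [hsum] at e₄
  rw [hw₀v] at e₂
  -- Finally `w₁` is replaced by the prescribed `w'`.
  obtain ⟨p₅, hp₅, e₅⟩ := exists_lowerGL_mul_upperGL_eq hκ hv' (hw₁v'.trans hw'.symm)
  refine ⟨_, mul_mem hp₅ (mul_mem hp₄ (mul_mem hp₃ (mul_mem hp₂ hp₁))), ?_⟩
  have hut : upperGL (fromRows t₀ t₁) = upperGL (fromRows t₀ t₁ - u) * upperGL u := by
    rw [upperGL_mul, sub_add_cancel]
  rw [hut]
  generalize fromRows t₀ t₁ - u = d at *
  generalize v + fromRows t₀ t₁ * (1 + b) = v' at *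
  calc upperGL d * upperGL u * lowerGL w * upperGL v
      = upperGL d * upperGL u * (lowerGL w * upperGL v) := by simp only [mul_assoc]
    _ = upperGL d * (upperGL u * lowerGL w₀ * upperGL v) * p₁ := by
        rw [e₁]; simp only [mul_assoc]
    _ = upperGL d * (lowerGL w₀ * upperGL (v + u * (1 + b))) *
        (cornerGL (Fin 1) (oneAddGL u w₀ hw₀u) * p₁) := by
        rw [e₂]; simp only [mul_assoc]
    _ = upperGL d * lowerGL w₁ * upperGL (v + u * (1 + b)) *
        (p₃ * (cornerGL (Fin 1) (oneAddGL u w₀ hw₀u) * p₁)) := by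
        rw [e₃]; simp only [mul_assoc]
    _ = _ := by rw [e₄, e₅]; simp only [mul_assoc]

/-- The left factor of `U(t) L(w) U(v)` can be absorbed, modulo `lowerAffine`, whenever the upper
part of the last column stays unimodular. Conjugation by an elementary `D(s)` reduces this to the
case in which `v` is a basis column. -/
theorem exists_upperGL_mul_lowerGL_mul_upperGL_eq (hκ : StableFor κ R)
    (t : Matrix (κ ⊕ Fin 1) (Fin 1) R) (w : Matrix (Fin 1) (κ ⊕ Fin 1) R)
    {v : Matrix (κ ⊕ Fin 1) (Fin 1) R} (hv : Unimodular v)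
    (hv' : Unimodular (v + t * (1 + w * v))) :
    ∃ w', ∃ p ∈ lowerAffine (κ ⊕ Fin 1) R, upperGL t * lowerGL w * upperGL v =
      lowerGL w' * upperGL (v + t * (1 + w * v)) * p := by
  obtain ⟨s, hs, hsv⟩ := exists_mul_eq_lastCol hκ hv
  have hwv : w * s⁻¹.val * lastCol κ R = w * v := by
    rw [← hsv, Matrix.mul_assoc, ← Matrix.mul_assoc _ s.val, Units.inv_mul, Matrix.one_mul]
  have hsv' : lastCol κ R + s.val * t * (1 + w * s⁻¹.val * lastCol κ R) =
      s.val * (v + t * (1 + w * v)) := by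
    rw [hwv, Matrix.mul_add s.val, hsv, Matrix.mul_assoc]
  have hu := hsv' ▸ hv'.unit_mul s
  obtain ⟨q, hq⟩ := hu
  obtain ⟨p, hp, e⟩ := exists_upperGL_mul_lowerGL_mul_upperGL_lastCol_eq hκ (s.val * t)
    (w * s⁻¹.val) (w * s⁻¹.val * lastCol κ R * q) ⟨q, hq⟩
    (by rw [Matrix.mul_assoc, hq, Matrix.mul_one])
  generalize w * s⁻¹.val * lastCol κ R * q = w' at *
  have hs' := cornerGL_mem_lowerAffine hs
  refine ⟨w' * s.val, _, mul_mem (mul_mem (inv_mem hs') hp) hs', ?_⟩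
  rw [hsv', ← hsv] at e
  generalize v + t * (1 + w * v) = v' at *
  have c₁ : upperGL (s.val * t) * lowerGL (w * s⁻¹.val) * upperGL (s.val * v) =
      cornerGL (Fin 1) s * (upperGL t * lowerGL w * upperGL v) * (cornerGL (Fin 1) s)⁻¹ := by
    rw [eq_mul_inv_iff_mul_eq]
    rw [mul_assoc, ← cornerGL_mul_upperGL, mul_assoc, ← mul_assoc (lowerGL _),
      ← cornerGL_mul_lowerGL, mul_assoc, ← mul_assoc, ← cornerGL_mul_upperGL]
    simp only [mul_assoc]
  have c₂ : lowerGL w' * upperGL (s.val * v') =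
      cornerGL (Fin 1) s * (lowerGL (w' * s.val) * upperGL v') * (cornerGL (Fin 1) s)⁻¹ := by
    rw [eq_mul_inv_iff_mul_eq, mul_assoc, ← cornerGL_mul_upperGL, ← mul_assoc,
      lowerGL_mul_cornerGL, mul_assoc]
  rw [c₁, c₂] at e
  rw [mul_inv_eq_iff_eq_mul] at e
  have e' := congrArg ((cornerGL (Fin 1) s)⁻¹ * ·) e
  simpa [mul_assoc] using e'

/-- The set of all products `U(t) L(w) U(v) p` with `v` unimodular and `p` in `lowerAffine`. It
contains the elementary group of `ι ⊕ Fin 1`. -/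
def bigCell (ι R : Type*) [Fintype ι] [DecidableEq ι] [Ring R] :
    Set (Matrix (ι ⊕ Fin 1) (ι ⊕ Fin 1) R)ˣ :=
  {g | ∃ t w v, Unimodular v ∧ ∃ p ∈ lowerAffine ι R, g = upperGL t * lowerGL w * upperGL v * p}

theorem upperGL_mul_mem_bigCell (u : Matrix ι (Fin 1) R)
    {g : (Matrix (ι ⊕ Fin 1) (ι ⊕ Fin 1) R)ˣ} (hg : g ∈ bigCell ι R) :
    upperGL u * g ∈ bigCell ι R := by
  obtain ⟨t, w, v, hv, p, hp, rfl⟩ := hg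
  refine ⟨u + t, w, v, hv, p, hp, ?_⟩
  rw [← upperGL_mul]
  simp only [mul_assoc]

theorem cornerGL_mul_mem_bigCell {s : (Matrix ι ι R)ˣ} (hs : s ∈ elementaryGroup ι R)
    {g : (Matrix (ι ⊕ Fin 1) (ι ⊕ Fin 1) R)ˣ} (hg : g ∈ bigCell ι R) :
    cornerGL (Fin 1) s * g ∈ bigCell ι R := by
  obtain ⟨t, w, v, hv, p, hp, rfl⟩ := hg
  refine ⟨s.val * t, w * s⁻¹.val, s.val * v, hv.unit_mul s, _,
    mul_mem (cornerGL_mem_lowerAffine hs) hp, ?_⟩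
  rw [← mul_assoc, ← mul_assoc, ← mul_assoc, cornerGL_mul_upperGL, mul_assoc _ _ (lowerGL w),
    cornerGL_mul_lowerGL, ← mul_assoc, mul_assoc _ _ (upperGL v), cornerGL_mul_upperGL]
  simp only [mul_assoc]

/-- The spare coordinate, by which the number of rows exceeds the stable range, makes it possible
to choose the left factor `U(t)` so that it almost commutes with the given `L(f)`. -/
theorem lowerGL_fromCols_mul_mem_bigCell (hκ : StableFor κ R) (f : Matrix (Fin 1) (Fin 1) R)
    {g : (Matrix ((κ ⊕ Fin 1) ⊕ Fin 1) ((κ ⊕ Fin 1) ⊕ Fin 1) R)ˣ}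
    (hg : g ∈ bigCell (κ ⊕ Fin 1) R) :
    lowerGL (fromCols 0 f) * g ∈ bigCell (κ ⊕ Fin 1) R := by
  obtain ⟨t, w, v, hv, p, hp, rfl⟩ := hg
  obtain ⟨x, b, hxb⟩ : ∃ x b, v + t * (1 + w * v) = fromRows x b :=
    ⟨_, _, (fromRows_toRows _).symm⟩
  -- With `1 + w v` the last entry of the last column, a multiple of it is added to the entries
  -- other than `b` so that the column above it becomes unimodular. Stability is applied to `x` and
  -- a combination of the two entries `b` and `1 + w v`.
  obtain ⟨τ, hτ⟩ : ∃ τ : Matrix κ (Fin 1) R,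
      Unimodular (v + (fromRows τ 0 + t) * (1 + w * v)) := by
    obtain ⟨e, he⟩ := hv
    have : ∃ (P : Matrix (Fin 1) κ R) (Q C : Matrix (Fin 1) (Fin 1) R),
        P * x + (Q * b + C * (1 + w * v)) = 1 := by
      obtain ⟨P, Q, hPQ⟩ : ∃ x a, e = fromCols x a := ⟨_, _, (fromCols_toCols _).symm⟩
      refine ⟨P, Q, -(e * t), ?_⟩
      rw [← add_assoc, ← fromCols_mul_fromRows, ← hPQ, ← hxb, Matrix.mul_add, he, Matrix.neg_mul,
        ← Matrix.mul_assoc, add_neg_cancel_right]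
    obtain ⟨P, Q, C, h⟩ := this
    obtain ⟨τ, q, hq⟩ := hκ x (Q * b + C * (1 + w * v)) P 1 (by rw [Matrix.one_mul, h])
    refine ⟨τ * C, fromCols q (q * τ * Q), ?_⟩
    rw [Matrix.add_mul, add_left_comm, hxb, fromRows_mul, Matrix.mul_add, fromCols_mul_fromRows,
      fromCols_mul_fromRows]
    refine Eq.trans ?_ hq
    simp only [Matrix.mul_add, Matrix.mul_assoc, Matrix.zero_mul, Matrix.mul_zero]
    abel
  obtain ⟨w', p', hp', e⟩ := exists_upperGL_mul_lowerGL_mul_upperGL_eq hκ _ w hv hτ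
  have h0 : fromCols (0 : Matrix (Fin 1) κ R) f *
      fromRows τ (0 : Matrix (Fin 1) (Fin 1) R) = 0 := by
    simp [fromCols_mul_fromRows]
  have hε := oneAddGL_mem_of_fromRows_fromCols τ f h0
  have e' : upperGL t * lowerGL w * upperGL v * p = upperGL (-fromRows τ 0) *
      (lowerGL w' * upperGL (v + (fromRows τ 0 + t) * (1 + w * v)) * (p' * p)) := by
    rw [← upperGL_inv, eq_inv_mul_iff_mul_eq, ← mul_assoc _ p' p, ← e, ← upperGL_mul]
    simp only [mul_assoc]
  rw [e', ← mul_assoc, lowerGL_mul_upperGL_neg _ _ h0, mul_assoc, mul_assoc]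
  refine upperGL_mul_mem_bigCell _ ?_
  refine ⟨0, fromCols 0 f + w' * (oneAddGL _ _ h0)⁻¹.val, _, hτ.unit_mul (oneAddGL _ _ h0), _,
    mul_mem (cornerGL_mem_lowerAffine hε) (mul_mem hp' hp), ?_⟩
  simp only [upperGL_zero, one_mul, ← lowerGL_mul, mul_assoc]
  congr 1
  rw [← mul_assoc (cornerGL _ _), cornerGL_mul_lowerGL, mul_assoc,
    ← mul_assoc (cornerGL _ _) (upperGL _), cornerGL_mul_upperGL, mul_assoc]

/-- The general `L(f)` is generated by the conjugates, under the elementary group, of those whose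
row is supported at the spare coordinate. -/
theorem lowerGL_mul_mem_bigCell (hκ : StableFor κ R) (f : Matrix (Fin 1) (κ ⊕ Fin 1) R)
    {g : (Matrix ((κ ⊕ Fin 1) ⊕ Fin 1) ((κ ⊕ Fin 1) ⊕ Fin 1) R)ˣ}
    (hg : g ∈ bigCell (κ ⊕ Fin 1) R) : lowerGL f * g ∈ bigCell (κ ⊕ Fin 1) R := by
  induction f using Matrix.induction_on' generalizing g with
  | h_zero => rwa [lowerGL_zero, one_mul]
  | h_add p q hp hq => rw [← lowerGL_mul, mul_assoc]; exact hp (hq hg)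
  | h_std_basis i j a =>
    obtain rfl := Subsingleton.elim i 0
    rcases j with j | j
    · -- The row `(a e_j, 0)` is the difference of `(a e_j, a)` and `(0, a)`, and the former is
      -- conjugate to the latter.
      have hs : elementaryGL (Sum.inr 0) (Sum.inl j) (by simp) 1 ∈
        elementaryGroup (κ ⊕ Fin 1) R := elementaryGL_mem _ _
      set s : (Matrix (κ ⊕ Fin 1) (κ ⊕ Fin 1) R)ˣ :=
        elementaryGL (Sum.inr 0) (Sum.inl j) (by simp) 1
      have key : lowerGL (Matrix.single 0 (Sum.inl j) a) = cornerGL (Fin 1) s⁻¹ *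
          lowerGL (fromCols 0 (Matrix.single 0 0 a)) * cornerGL (Fin 1) s *
          lowerGL (fromCols 0 (Matrix.single 0 0 (-a))) := by
        rw [cornerGL_mul_lowerGL, mul_assoc (lowerGL _), ← map_mul, inv_mul_cancel, map_one,
          mul_one, lowerGL_mul]
        congr 1
        have : s.val = 1 + Matrix.single (Sum.inr 0) (Sum.inl j) 1 := rfl
        rw [inv_inv, this, Matrix.mul_add, Matrix.mul_one]
        have : fromCols (0 : Matrix (Fin 1) κ R) (Matrix.single (0 : Fin 1) (0 : Fin 1) a) =
            Matrix.single (0 : Fin 1) (Sum.inr (0 : Fin 1)) a := by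
          ext i j
          rcases j with j | j <;> simp [Matrix.single_apply]
        rw [this, Matrix.single_mul_single_same, mul_one]
        ext i k
        rcases k with k | k
        · simp [Matrix.single_apply]
        · obtain rfl := Subsingleton.elim i 0
          obtain rfl := Subsingleton.elim k 0
          simp
      rw [key]
      simp only [mul_assoc]
      exact cornerGL_mul_mem_bigCell (inv_mem hs) (lowerGL_fromCols_mul_mem_bigCell hκ _
        (cornerGL_mul_mem_bigCell hs (lowerGL_fromCols_mul_mem_bigCell hκ _ hg)))
    · have : Matrix.single (0 : Fin 1) (Sum.inr j) a =
          fromCols (0 : Matrix (Fin 1) κ R) (Matrix.single 0 j a) := by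
        ext i k
        rcases k with k | k <;> simp [Matrix.single_apply]
      rw [this]
      exact lowerGL_fromCols_mul_mem_bigCell hκ _ hg

theorem one_mem_bigCell : 1 ∈ bigCell (κ ⊕ Fin 1) R :=
  ⟨-lastCol κ R, 0, lastCol κ R, unimodular_lastCol, 1, one_mem _, by
    rw [lowerGL_zero, mul_one, mul_one, upperGL_mul, neg_add_cancel, upperGL_zero]⟩

theorem elementaryGroup_subset_bigCell (hκ : StableFor κ R) :
    (elementaryGroup ((κ ⊕ Fin 1) ⊕ Fin 1) R : Set _) ⊆ bigCell (κ ⊕ Fin 1) R := by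
  have key : ∀ (i j : (κ ⊕ Fin 1) ⊕ Fin 1) (hij : i ≠ j) (a : R),
      ∀ y ∈ bigCell (κ ⊕ Fin 1) R, elementaryGL i j hij a * y ∈ bigCell (κ ⊕ Fin 1) R := by
    rintro (i | i) (j | j) hij a y hy
    · rw [← cornerGL_elementaryGL (fun h => hij (congrArg _ h))]
      exact cornerGL_mul_mem_bigCell (elementaryGL_mem _ _) hy
    · rw [← upperGL_single]
      exact upperGL_mul_mem_bigCell _ hy
    · rw [← lowerGL_single]
      exact lowerGL_mul_mem_bigCell hκ _ hy
    · exact absurd (congrArg _ (Subsingleton.elim i j)) hij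
  intro g hg
  refine Subgroup.closure_induction_left (p := fun g _ => g ∈ bigCell (κ ⊕ Fin 1) R)
    one_mem_bigCell ?_ ?_ hg
  · rintro _ ⟨i, j, hij, a, rfl⟩ y _ hy
    exact key i j hij a y hy
  · rintro _ ⟨i, j, hij, a, rfl⟩ y _ hy
    rw [elementaryGL_inv]
    exact key i j hij _ y hy

/-- Injective stability for `K₁`: the elementary group does not become larger by stabilization, if
the size exceeds the stable range. -/
theorem mem_elementaryGroup_of_cornerGL_mem (hκ : StableFor κ R)
    {s : (Matrix (κ ⊕ Fin 1) (κ ⊕ Fin 1) R)ˣ}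
    (hs : cornerGL (Fin 1) s ∈ elementaryGroup ((κ ⊕ Fin 1) ⊕ Fin 1) R) :
    s ∈ elementaryGroup (κ ⊕ Fin 1) R := by
  obtain ⟨t, w, v, hv, _, ⟨z, σ, hσ, rfl⟩, e⟩ := elementaryGroup_subset_bigCell hκ hs
  have e' : cornerGL (Fin 1) (s * σ⁻¹) * lowerGL (-z) = upperGL t * lowerGL w * upperGL v := by
    rw [map_mul, map_inv, ← lowerGL_inv, e]
    group
  -- The last columns of both sides are compared.
  have e'' := congrArg Units.val e'
  simp only [Units.val_mul (cornerGL _ _), Units.val_mul (_ * _) (upperGL v),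
    Units.val_mul (upperGL t), val_cornerGL, val_upperGL, val_lowerGL, fromBlocks_multiply,
    fromBlocks_inj, Matrix.mul_zero, Matrix.zero_mul, Matrix.mul_one, Matrix.one_mul, add_zero,
    zero_add, Matrix.add_mul] at e''
  obtain ⟨h₁, h₂, -, h₄⟩ := e''
  have hwv : w * v = 0 := by simpa using h₄
  have ht : t = -v := by
    rw [Matrix.mul_assoc, hwv, Matrix.mul_zero, add_zero] at h₂
    exact eq_neg_of_add_eq_zero_right h₂.symm
  have hσs : s = oneAddGL v (-w) (by rw [Matrix.neg_mul, hwv, neg_zero]) * σ := by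
    rw [← mul_inv_eq_iff_eq_mul]
    ext1
    rw [h₁, val_oneAddGL, ht]
    simp
  rw [hσs]
  exact mul_mem (oneAddGL_mem hκ hv _ _) hσ

end InjectiveStability

/-! ### Reindexing -/

section Reindex

variable {ι κ R : Type*} [Fintype ι] [DecidableEq ι] [Fintype κ] [DecidableEq κ] [Ring R]

/-- Relabelling of the indices of an invertible matrix. -/
def reindexGL (e : ι ≃ κ) : (Matrix ι ι R)ˣ ≃* (Matrix κ κ R)ˣ :=
  Units.mapEquiv (Matrix.reindexRingEquiv R e : Matrix ι ι R ≃* Matrix κ κ R)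

theorem val_reindexGL (e : ι ≃ κ) (s : (Matrix ι ι R)ˣ) :
    (reindexGL e s).val = s.val.submatrix e.symm e.symm := rfl

theorem reindexGL_elementaryGL (e : ι ≃ κ) {i j : ι} (hij : i ≠ j) (a : R) :
    reindexGL e (elementaryGL i j hij a) = elementaryGL (e i) (e j) (e.injective.ne hij) a := by
  ext1
  ext x y
  simp [val_reindexGL, elementaryGL, Matrix.single_apply, Matrix.one_apply, Equiv.eq_symm_apply]

theorem reindexGL_mem (e : ι ≃ κ) {s : (Matrix ι ι R)ˣ} (hs : s ∈ elementaryGroup ι R) :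
    reindexGL e s ∈ elementaryGroup κ R := by
  have : elementaryGroup ι R ≤ (elementaryGroup κ R).comap (reindexGL e).toMonoidHom := by
    refine (Subgroup.closure_le _).2 ?_
    rintro _ ⟨i, j, hij, a, rfl⟩
    simp only [MulEquiv.toMonoidHom_eq_coe, Subgroup.coe_comap, MonoidHom.coe_coe,
      Set.mem_preimage, SetLike.mem_coe, reindexGL_elementaryGL]
    exact elementaryGL_mem _ _
  exact this hs

theorem reindexGL_mem_iff (e : ι ≃ κ) {s : (Matrix ι ι R)ˣ} :
    reindexGL e s ∈ elementaryGroup κ R ↔ s ∈ elementaryGroup ι R := by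
  refine ⟨fun h => ?_, reindexGL_mem e⟩
  have := reindexGL_mem e.symm h
  convert this
  ext1
  ext i j
  simp [val_reindexGL]

/-- The stable range condition in terms of sequences gives the one in terms of columns. -/
theorem stableFor_of_leftStableRangeLE {r : ℕ} (hr : LeftStableRangeLE R r)
    (hκ : r ≤ Fintype.card κ) : StableFor κ R := by
  intro x a p q hpq
  set e := (Fintype.equivFin κ).symm
  have huni : IsLeftUnimodular
      (Fin.snoc (fun i => x (e i) 0) (a 0 0) : Fin (Fintype.card κ + 1) → R) := by
    rw [IsLeftUnimodular, Ideal.eq_top_iff_one, Ideal.mem_span_range_iff_exists_fun]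
    refine ⟨Fin.snoc (fun i => p 0 (e i)) (q 0 0), ?_⟩
    have := congrFun (congrFun hpq 0) 0
    simp only [Matrix.add_apply, Matrix.mul_apply, Matrix.one_apply_eq] at this
    rw [← this, Fin.sum_univ_castSucc, ← e.sum_comp (fun i => p 0 i * x i 0)]
    simp
  obtain ⟨t, ht⟩ := hr _ (by omega) _ huni
  rw [IsLeftUnimodular, Ideal.eq_top_iff_one, Ideal.mem_span_range_iff_exists_fun] at ht
  obtain ⟨c, hc⟩ := ht
  refine ⟨Matrix.of fun i _ => t (e.symm i), Matrix.of fun _ i => c (e.symm i), ?_⟩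
  ext i j
  obtain rfl := Subsingleton.elim i 0
  obtain rfl := Subsingleton.elim j 0
  rw [Matrix.mul_apply, Matrix.one_apply_eq, ← hc, ← e.sum_comp]
  refine Finset.sum_congr rfl fun i _ => ?_
  simp [Matrix.mul_apply]

theorem leftStableRangeLE_of_stableRange_eq {r : ℕ} (hr : stableRange R = (r : ℕ∞)) :
    LeftStableRangeLE R r := by
  have h : stableRange R < ((r + 1 : ℕ) : ℕ∞) := by rw [hr]; exact_mod_cast r.lt_succ_self
  rw [stableRange, iInf_lt_iff] at h
  obtain ⟨k, hk⟩ := h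
  rw [iInf_lt_iff] at hk
  obtain ⟨⟨-, hk⟩, hkr⟩ := hk
  have hkr' : k < r + 1 := by exact_mod_cast hkr
  exact fun m hm => hk m (by omega)

end Reindex

/-! ### Stabilization by one row and column -/

section Stabilization

variable {ι κ R : Type*} [Fintype ι] [DecidableEq ι] [Ring R]

/-- The stabilization `s ↦ [s, 0; 0, 1]` from size `m` to size `m + 1`. -/
def stabGL (m : ℕ) : (Matrix (Fin m) (Fin m) R)ˣ →* (Matrix (Fin (m + 1)) (Fin (m + 1)) R)ˣ :=
  (reindexGL finSumFinEquiv).toMonoidHom.comp (cornerGL (Fin 1))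

theorem stabGL_apply {m : ℕ} (s : (Matrix (Fin m) (Fin m) R)ˣ) :
    stabGL m s = reindexGL finSumFinEquiv (cornerGL (Fin 1) s) := rfl

theorem mem_EL_of_stabGL_mem {r m : ℕ} (hr : LeftStableRangeLE R r) (hm : r < m)
    {s : (Matrix (Fin m) (Fin m) R)ˣ} (hs : stabGL m s ∈ EL (m + 1) R) : s ∈ EL m R := by
  obtain ⟨m, rfl⟩ : ∃ k, m = k + 1 := ⟨m - 1, by omega⟩
  obtain ⟨s, rfl⟩ := (reindexGL (R := R) (finSumFinEquiv (m := m) (n := 1))).surjective s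
  refine reindexGL_mem _ ?_
  refine mem_elementaryGroup_of_cornerGL_mem
    (stableFor_of_leftStableRangeLE hr (by rw [Fintype.card_fin]; omega)) ?_
  rw [← reindexGL_mem_iff ((finSumFinEquiv.sumCongr (Equiv.refl (Fin 1))).trans finSumFinEquiv)]
  replace hs : stabGL (m + 1) (reindexGL finSumFinEquiv s) ∈
      elementaryGroup (Fin (m + 1 + 1)) R := hs
  convert hs using 1
  ext1
  rw [stabGL_apply, val_reindexGL, val_reindexGL, val_cornerGL, val_cornerGL, val_reindexGL]
  ext i j
  simp only [Equiv.symm_trans_apply, submatrix_apply]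
  generalize finSumFinEquiv.symm i = i
  generalize finSumFinEquiv.symm j = j
  rcases i with i | i <;> rcases j with j | j <;> simp

/-- Surjective stability for `K₁`, in the form of a factorization. -/
theorem exists_eq_mul_cornerGL (hι : StableFor ι R) (g : (Matrix (ι ⊕ Fin 1) (ι ⊕ Fin 1) R)ˣ) :
    ∃ t w v z s, g = upperGL t * lowerGL w * upperGL v * lowerGL z * cornerGL (Fin 1) s := by
  obtain ⟨A, x, C, a, hg⟩ : ∃ A x C a, g.val = fromBlocks A x C a :=
    ⟨_, _, _, _, (fromBlocks_toBlocks _).symm⟩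
  obtain ⟨p, q, hpq⟩ : ∃ (p : Matrix (Fin 1) ι R) (q : Matrix (Fin 1) (Fin 1) R),
      p * x + q * a = 1 := by
    have h := g.inv_mul
    rw [← fromBlocks_toBlocks g⁻¹.val, hg, fromBlocks_multiply, ← fromBlocks_one,
      fromBlocks_inj] at h
    exact ⟨_, _, h.2.2.2⟩
  obtain ⟨t, e, he⟩ := hι x a p q hpq
  -- The row operation `L` turns the last entry into `1`, once the part above it is unimodular.
  set h := upperGL (-(x + t * a)) * lowerGL ((1 - a) * e) * upperGL t * g with hh
  obtain ⟨A', C', hh'⟩ : ∃ A' C', h.val = fromBlocks A' 0 C' 1 := by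
    have h₁ : (1 - a) * e * (x + t * a) + a = 1 := by rw [Matrix.mul_assoc, he]; simp
    refine ⟨A + t * C - (x + t * a) * ((1 - a) * e * (A + t * C) + C),
      (1 - a) * e * (A + t * C) + C, ?_⟩
    rw [hh]
    simp only [mul_assoc]
    rw [Units.val_mul, Units.val_mul, Units.val_mul, hg, val_upperGL, val_upperGL, val_lowerGL]
    simp only [fromBlocks_multiply, Matrix.one_mul, Matrix.zero_mul, add_zero, zero_add, h₁]
    rw [Matrix.neg_mul, Matrix.mul_one, add_neg_cancel, ← sub_eq_add_neg]
  obtain ⟨s, z, hs⟩ : ∃ s z, h = lowerGL z * cornerGL (Fin 1) s := by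
    have h₁ := h.inv_mul
    have h₂ := h.mul_inv
    obtain ⟨P, Q, S, T, hP⟩ : ∃ A x C a, h⁻¹.val = fromBlocks A x C a :=
      ⟨_, _, _, _, (fromBlocks_toBlocks _).symm⟩
    rw [hP, hh', fromBlocks_multiply, ← fromBlocks_one, fromBlocks_inj] at h₁ h₂
    have hQ : Q = 0 := by simpa using h₁.2.1
    have hPA : P * A' = 1 := by simpa [hQ] using h₁.1
    refine ⟨⟨A', P, by simpa using h₂.1, hPA⟩, C' * P, ?_⟩
    ext1
    rw [hh', Units.val_mul, val_lowerGL, val_cornerGL, fromBlocks_multiply]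
    simp [Matrix.mul_assoc, hPA]
  refine ⟨-t, -((1 - a) * e), x + t * a, z, s, ?_⟩
  rw [mul_assoc _ (lowerGL z), ← hs, hh, ← upperGL_inv, ← lowerGL_inv, ← upperGL_inv]
  group

end Stabilization

/-! ### Unitriangular matrices -/

section Unitriangular

variable {R : Type*} [Ring R]

/-- Upper triangular matrices with ones on the diagonal. -/
def UpperUni {m : ℕ} (M : Matrix (Fin m) (Fin m) R) : Prop :=
  (∀ i, M i i = 1) ∧ ∀ i j, j < i → M i j = 0

/-- Lower triangular matrices with ones on the diagonal. -/
def LowerUni {m : ℕ} (M : Matrix (Fin m) (Fin m) R) : Prop :=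
  (∀ i, M i i = 1) ∧ ∀ i j, i < j → M i j = 0

theorem upperUni_one {m : ℕ} : UpperUni (1 : Matrix (Fin m) (Fin m) R) :=
  ⟨fun _ => Matrix.one_apply_eq _, fun _ _ h => Matrix.one_apply_ne h.ne'⟩

theorem lowerUni_one {m : ℕ} : LowerUni (1 : Matrix (Fin m) (Fin m) R) :=
  ⟨fun _ => Matrix.one_apply_eq _, fun _ _ h => Matrix.one_apply_ne h.ne⟩

theorem forall_fin_succ_iff_finSumFinEquiv {m : ℕ} {P : Fin (m + 1) → Prop} :
    (∀ i, P i) ↔ (∀ i : Fin m, P (finSumFinEquiv (Sum.inl i))) ∧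
      P (finSumFinEquiv (Sum.inr (0 : Fin 1))) := by
  rw [← finSumFinEquiv.forall_congr_right, Sum.forall, Fin.forall_fin_one]

theorem upperUni_reindex_fromBlocks_iff {m : ℕ} {A : Matrix (Fin m) (Fin m) R}
    {t : Matrix (Fin m) (Fin 1) R} {w : Matrix (Fin 1) (Fin m) R} {a : Matrix (Fin 1) (Fin 1) R} :
    UpperUni ((fromBlocks A t w a).submatrix finSumFinEquiv.symm finSumFinEquiv.symm) ↔
      UpperUni A ∧ w = 0 ∧ a = 1 := by
  have hw : w = 0 ↔ ∀ i, w 0 i = 0 := by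
    rw [← Matrix.ext_iff, Fin.forall_fin_one]; rfl
  have ha : a = 1 ↔ a 0 0 = 1 := by
    rw [← Matrix.ext_iff, Fin.forall_fin_one, Fin.forall_fin_one]; rfl
  have hlt : ∀ i : Fin m, (i : ℕ) < m := fun i => i.2
  have hle : ∀ i : Fin m, (i : ℕ) ≤ m := fun i => i.2.le
  simp only [UpperUni, forall_fin_succ_iff_finSumFinEquiv, submatrix_apply,
    Equiv.symm_apply_apply, fromBlocks_apply₁₁, fromBlocks_apply₁₂, fromBlocks_apply₂₁,
    fromBlocks_apply₂₂, hw, ha]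
  simp only [Fin.lt_def, finSumFinEquiv_apply_left, finSumFinEquiv_apply_right,
    Fin.val_castAdd, Fin.val_natAdd, Fin.val_zero, add_zero, hlt, lt_irrefl, (hle _).not_gt,
    forall_true_left, IsEmpty.forall_iff, and_true]
  tauto

theorem lowerUni_reindex_fromBlocks_iff {m : ℕ} {A : Matrix (Fin m) (Fin m) R}
    {t : Matrix (Fin m) (Fin 1) R} {w : Matrix (Fin 1) (Fin m) R} {a : Matrix (Fin 1) (Fin 1) R} :
    LowerUni ((fromBlocks A t w a).submatrix finSumFinEquiv.symm finSumFinEquiv.symm) ↔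
      LowerUni A ∧ t = 0 ∧ a = 1 := by
  have ht : t = 0 ↔ ∀ i, t i 0 = 0 := by
    simp_rw [← Matrix.ext_iff, Fin.forall_fin_one]; rfl
  have ha : a = 1 ↔ a 0 0 = 1 := by
    rw [← Matrix.ext_iff, Fin.forall_fin_one, Fin.forall_fin_one]; rfl
  have hlt : ∀ i : Fin m, (i : ℕ) < m := fun i => i.2
  have hle : ∀ i : Fin m, (i : ℕ) ≤ m := fun i => i.2.le
  simp only [LowerUni, forall_fin_succ_iff_finSumFinEquiv, submatrix_apply,
    Equiv.symm_apply_apply, fromBlocks_apply₁₁, fromBlocks_apply₁₂, fromBlocks_apply₂₁,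
    fromBlocks_apply₂₂, ht, ha]
  simp only [Fin.lt_def, finSumFinEquiv_apply_left, finSumFinEquiv_apply_right,
    Fin.val_castAdd, Fin.val_natAdd, Fin.val_zero, add_zero, hlt, lt_irrefl, (hle _).not_gt,
    forall_true_left, forall_and]
  tauto

/-- An upper unitriangular matrix is invertible and elementary. -/
theorem UpperUni.exists_mem_EL {m : ℕ} {M : Matrix (Fin m) (Fin m) R} (hM : UpperUni M) :
    ∃ u ∈ EL m R, u.val = M := by
  induction m with
  | zero => exact ⟨1, one_mem _, Subsingleton.elim _ _⟩
  | succ m ih =>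
    obtain ⟨A, t, w, a, rfl⟩ : ∃ A t w a, M = (fromBlocks A t w a).submatrix
        finSumFinEquiv.symm finSumFinEquiv.symm :=
      ⟨_, _, _, _, by rw [fromBlocks_toBlocks (M.submatrix finSumFinEquiv finSumFinEquiv)]; simp⟩
    obtain ⟨hA, rfl, rfl⟩ := upperUni_reindex_fromBlocks_iff.1 hM
    obtain ⟨u, hu, rfl⟩ := ih hA
    refine ⟨reindexGL finSumFinEquiv (upperGL t * cornerGL (Fin 1) u),
      reindexGL_mem _ (mul_mem (upperGL_mem _) (cornerGL_mem hu)), ?_⟩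
    rw [val_reindexGL, Units.val_mul, val_upperGL, val_cornerGL, fromBlocks_multiply]
    simp

/-- A lower unitriangular matrix is invertible and elementary. -/
theorem LowerUni.exists_mem_EL {m : ℕ} {M : Matrix (Fin m) (Fin m) R} (hM : LowerUni M) :
    ∃ u ∈ EL m R, u.val = M := by
  induction m with
  | zero => exact ⟨1, one_mem _, Subsingleton.elim _ _⟩
  | succ m ih =>
    obtain ⟨A, t, w, a, rfl⟩ : ∃ A t w a, M = (fromBlocks A t w a).submatrix
        finSumFinEquiv.symm finSumFinEquiv.symm :=
      ⟨_, _, _, _, by rw [fromBlocks_toBlocks (M.submatrix finSumFinEquiv finSumFinEquiv)]; simp⟩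
    obtain ⟨hA, rfl, rfl⟩ := lowerUni_reindex_fromBlocks_iff.1 hM
    obtain ⟨u, hu, rfl⟩ := ih hA
    refine ⟨reindexGL finSumFinEquiv (cornerGL (Fin 1) u * lowerGL w),
      reindexGL_mem _ (mul_mem (cornerGL_mem hu) (lowerGL_mem _)), ?_⟩
    rw [val_reindexGL, Units.val_mul, val_lowerGL, val_cornerGL, fromBlocks_multiply]
    simp

theorem UpperUni.mem_EL {m : ℕ} {u : (Matrix (Fin m) (Fin m) R)ˣ} (hu : UpperUni u.val) :
    u ∈ EL m R := by
  obtain ⟨u', hu', h⟩ := hu.exists_mem_EL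
  rwa [← Units.ext h]

theorem LowerUni.mem_EL {m : ℕ} {u : (Matrix (Fin m) (Fin m) R)ˣ} (hu : LowerUni u.val) :
    u ∈ EL m R := by
  obtain ⟨u', hu', h⟩ := hu.exists_mem_EL
  rwa [← Units.ext h]

/-! ### Factorization into unitriangular matrices and a corner -/

/-- The iterated stabilization from size `d` to size `d + k`. -/
def iterStabGL (d : ℕ) : ∀ k, (Matrix (Fin d) (Fin d) R)ˣ →*
    (Matrix (Fin (d + k)) (Fin (d + k)) R)ˣ
  | 0 => MonoidHom.id _
  | k + 1 => (stabGL (d + k)).comp (iterStabGL d k)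

theorem iterStabGL_succ (d k : ℕ) (s : (Matrix (Fin d) (Fin d) R)ˣ) :
    iterStabGL d (k + 1) s = stabGL (d + k) (iterStabGL d k s) := rfl

/-- Conjugating by the matrices already found in the smaller size collects the factors of equal
type, so that the number of unitriangular factors does not grow with `k`. -/
theorem exists_eq_mul_iterStabGL {d k : ℕ} (hd : ∀ m, d ≤ m → StableFor (Fin m) R)
    (g : (Matrix (Fin (d + k)) (Fin (d + k)) R)ˣ) :
    ∃ A B C D s, UpperUni A.val ∧ LowerUni B.val ∧ UpperUni C.val ∧ LowerUni D.val ∧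
      g = A * B * C * D * iterStabGL d k s := by
  induction k with
  | zero =>
    exact ⟨1, 1, 1, 1, g, upperUni_one, lowerUni_one, upperUni_one, lowerUni_one, by
      simp [iterStabGL]⟩
  | succ k ih =>
    obtain ⟨g, rfl⟩ := (reindexGL (R := R) (finSumFinEquiv (m := d + k) (n := 1))).surjective g
    obtain ⟨t, w, v, z, g', rfl⟩ := exists_eq_mul_cornerGL (hd _ (Nat.le_add_right d k)) g
    obtain ⟨A, B, C, D, s, hA, hB, hC, hD, rfl⟩ := ih g'
    let e : (Matrix (Fin (d + k) ⊕ Fin 1) (Fin (d + k) ⊕ Fin 1) R)ˣ ≃*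
        (Matrix (Fin (d + (k + 1))) (Fin (d + (k + 1))) R)ˣ := reindexGL finSumFinEquiv
    refine ⟨e (upperGL t * cornerGL (Fin 1) A),
      e (lowerGL (w * A.val) * cornerGL (Fin 1) B),
      e (upperGL ((A * B)⁻¹.val * v) * cornerGL (Fin 1) C),
      e (lowerGL (z * (A * B * C).val) * cornerGL (Fin 1) D), s,
      ?_, ?_, ?_, ?_, ?_⟩
    · rw [val_reindexGL, Units.val_mul, val_upperGL, val_cornerGL, fromBlocks_multiply]
      exact upperUni_reindex_fromBlocks_iff.2 (by simpa using hA)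
    · rw [val_reindexGL, Units.val_mul, val_lowerGL, val_cornerGL, fromBlocks_multiply]
      exact lowerUni_reindex_fromBlocks_iff.2 (by simpa using hB)
    · rw [val_reindexGL, Units.val_mul, val_upperGL, val_cornerGL, fromBlocks_multiply]
      exact upperUni_reindex_fromBlocks_iff.2 (by simpa using hC)
    · rw [val_reindexGL, Units.val_mul, val_lowerGL, val_cornerGL, fromBlocks_multiply]
      exact lowerUni_reindex_fromBlocks_iff.2 (by simpa using hD)
    · rw [iterStabGL_succ, stabGL_apply, ← map_mul, ← map_mul, ← map_mul, ← map_mul]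
      congr 1
      have e₁ : lowerGL w * cornerGL (Fin 1) A = cornerGL (Fin 1) A * lowerGL (w * A.val) :=
        lowerGL_mul_cornerGL A w
      have e₂ := upperGL_mul_cornerGL (A * B) v
      have e₃ := lowerGL_mul_cornerGL (A * B * C) z
      generalize lowerGL (z * (A * B * C).val) = Z at *
      generalize upperGL ((A * B)⁻¹.val * v) = V at *
      generalize lowerGL (w * A.val) = W at *
      simp only [map_mul] at *
      calc _ = upperGL t * lowerGL w * upperGL v * (lowerGL z * (cornerGL (Fin 1) A *
            cornerGL (Fin 1) B * cornerGL (Fin 1) C)) * cornerGL (Fin 1) D *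
            cornerGL (Fin 1) (iterStabGL d k s) := by simp only [mul_assoc]
        _ = upperGL t * lowerGL w * (upperGL v * (cornerGL (Fin 1) A * cornerGL (Fin 1) B)) *
            cornerGL (Fin 1) C * Z * cornerGL (Fin 1) D *
            cornerGL (Fin 1) (iterStabGL d k s) := by rw [e₃]; simp only [mul_assoc]
        _ = upperGL t * (lowerGL w * cornerGL (Fin 1) A) * cornerGL (Fin 1) B * V *
            cornerGL (Fin 1) C * Z * cornerGL (Fin 1) D *
            cornerGL (Fin 1) (iterStabGL d k s) := by rw [e₂]; simp only [mul_assoc]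
        _ = _ := by rw [e₁]; simp only [mul_assoc]

theorem mem_EL_of_iterStabGL_mem {r d k : ℕ} (hr : LeftStableRangeLE R r) (hd : r < d)
    {s : (Matrix (Fin d) (Fin d) R)ˣ} (hs : iterStabGL d k s ∈ EL (d + k) R) : s ∈ EL d R := by
  induction k with
  | zero => exact hs
  | succ k ih => exact ih (mem_EL_of_stabGL_mem hr (by omega) hs)

theorem val_stabGL_apply {m : ℕ} (s : (Matrix (Fin m) (Fin m) R)ˣ) (i j : Fin (m + 1)) :
    (stabGL m s).val i j = if h : i.val < m ∧ j.val < m then s.val ⟨i, h.1⟩ ⟨j, h.2⟩ else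
      (1 : Matrix _ _ R) i j := by
  rw [stabGL_apply, val_reindexGL, val_cornerGL, submatrix_apply]
  obtain ⟨i, rfl⟩ := finSumFinEquiv.surjective i
  obtain ⟨j, rfl⟩ := finSumFinEquiv.surjective j
  rw [Equiv.symm_apply_apply, Equiv.symm_apply_apply]
  simp only [Matrix.one_apply, finSumFinEquiv.injective.eq_iff]
  rcases i with i | i <;> rcases j with j | j <;> simp [Matrix.one_apply]

theorem val_iterStabGL_apply {d k : ℕ} (s : (Matrix (Fin d) (Fin d) R)ˣ) (i j : Fin (d + k)) :
    (iterStabGL d k s).val i j = if h : i.val < d ∧ j.val < d then s.val ⟨i, h.1⟩ ⟨j, h.2⟩ else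
      (1 : Matrix _ _ R) i j := by
  induction k with
  | zero =>
    rw [dif_pos ⟨i.2, j.2⟩]
    rfl
  | succ k ih =>
    rw [iterStabGL_succ, val_stabGL_apply]
    by_cases h : i.val < d + k ∧ j.val < d + k
    · rw [dif_pos h, ih]
      simp only [Matrix.one_apply, Fin.ext_iff]
    · rw [dif_neg h, dif_neg (by omega)]

theorem cornerEmbed_apply {d N : ℕ} (h : d ≤ N) (S : Matrix (Fin d) (Fin d) R) (i j : Fin N) :
    cornerEmbed h S i j = if h : i.val < d ∧ j.val < d then S ⟨i, h.1⟩ ⟨j, h.2⟩ else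
      (1 : Matrix _ _ R) i j := by
  set e := finSumFinEquiv.trans (finCongr (Nat.add_sub_of_le h))
  have hl : ∀ i : Fin d, (e (Sum.inl i)).val = i.val := fun i => rfl
  have hr : ∀ i : Fin (N - d), (e (Sum.inr i)).val = d + i.val := fun i => rfl
  have : cornerEmbed h S = (fromBlocks S 0 0 1).submatrix e.symm e.symm := rfl
  rw [this, submatrix_apply]
  obtain ⟨i, rfl⟩ := e.surjective i
  obtain ⟨j, rfl⟩ := e.surjective j
  rw [Equiv.symm_apply_apply, Equiv.symm_apply_apply]
  simp only [Matrix.one_apply, e.injective.eq_iff]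
  rcases i with i | i <;> rcases j with j | j <;> simp [Matrix.one_apply, hl, hr]

/-- An invertible matrix of size `N` is the product of four unitriangular ones and of a matrix
from the upper left corner; the corner is elementary if the given matrix is. -/
theorem exists_eq_mul_cornerEmbed {r d N : ℕ} (hr : LeftStableRangeLE R r) (hd : r < d)
    (hN : d ≤ N) (g : (Matrix (Fin N) (Fin N) R)ˣ) (hg : g ∈ EL N R) :
    ∃ A B C D : (Matrix (Fin N) (Fin N) R)ˣ, ∃ s ∈ EL d R,
      UpperUni A.val ∧ LowerUni B.val ∧ UpperUni C.val ∧ LowerUni D.val ∧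
      g.val = (A * B * C * D).val * cornerEmbed hN s.val := by
  obtain ⟨k, rfl⟩ := Nat.exists_eq_add_of_le hN
  obtain ⟨A, B, C, D, s, hA, hB, hC, hD, rfl⟩ := exists_eq_mul_iterStabGL (d := d) (k := k)
    (fun m hm => stableFor_of_leftStableRangeLE hr (by rw [Fintype.card_fin]; omega)) g
  refine ⟨A, B, C, D, s, ?_, hA, hB, hC, hD, ?_⟩
  · refine mem_EL_of_iterStabGL_mem (k := k) hr hd ?_
    exact (Subgroup.mul_mem_cancel_left _ (mul_mem (mul_mem (mul_mem hA.mem_EL hB.mem_EL)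
      hC.mem_EL) hD.mem_EL)).1 hg
  · rw [Units.val_mul]
    congr 1
    ext i j
    rw [val_iterStabGL_apply, cornerEmbed_apply]

end Unitriangular

/-! ### Bounded products of elementary matrices -/

section Width

variable {ι A : Type*} [Fintype ι] [DecidableEq ι] [Ring A]

/-- The matrix is a product of at most `k` elementary matrices. -/
def HasWidth (k : ℕ) (g : (Matrix ι ι A)ˣ) : Prop :=
  ∃ L : List (Matrix ι ι A)ˣ, L.length ≤ k ∧ (∀ x ∈ L, x ∈ elementaryMatrices ι A) ∧ L.prod = g

theorem HasWidth.mul {k l : ℕ} {g h : (Matrix ι ι A)ˣ} (hg : HasWidth k g) (hh : HasWidth l h) :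
    HasWidth (k + l) (g * h) := by
  obtain ⟨L, hL, hL', rfl⟩ := hg
  obtain ⟨M, hM, hM', rfl⟩ := hh
  refine ⟨L ++ M, by rw [List.length_append]; omega, fun x hx => ?_, List.prod_append⟩
  exact (List.mem_append.1 hx).elim (hL' x) (hM' x)

theorem hasWidth_elementaryGL {i j : ι} (hij : i ≠ j) (x : A) :
    HasWidth 1 (elementaryGL i j hij x) :=
  ⟨[_], le_rfl, by simpa using ⟨i, j, hij, x, rfl⟩, by simp⟩

/-- The invertible diagonal matrices. -/
def diagGL (ι A : Type*) [Fintype ι] [DecidableEq ι] [Ring A] :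
    (ι → Aˣ) →* (Matrix ι ι A)ˣ where
  toFun u :=
    { val := diagonal fun i => (u i).val
      inv := diagonal fun i => (u i)⁻¹.val
      val_inv := by simp
      inv_val := by simp }
  map_one' := by ext1; simp
  map_mul' u v := by ext1; simp

theorem val_diagGL (u : ι → Aˣ) : (diagGL ι A u).val = diagonal fun i => (u i).val := rfl

theorem diagGL_mul_elementaryGL_mul_inv (u : ι → Aˣ) {i j : ι} (hij : i ≠ j) (x : A) :
    diagGL ι A u * elementaryGL i j hij x * (diagGL ι A u)⁻¹ =
      elementaryGL i j hij ((u i).val * x * (u j)⁻¹.val) := by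
  rw [mul_inv_eq_iff_eq_mul]
  ext1
  simp only [Units.val_mul, val_diagGL, elementaryGL, mul_add, add_mul, mul_one, one_mul]
  congr 1
  ext k l
  rw [diagonal_mul, mul_diagonal, single_apply, single_apply]
  split_ifs with h
  · obtain ⟨rfl, rfl⟩ := h
    simp [mul_assoc]
  · simp

theorem HasWidth.conj_diagGL {k : ℕ} {g : (Matrix ι ι A)ˣ} (hg : HasWidth k g) (u : ι → Aˣ) :
    HasWidth k (diagGL ι A u * g * (diagGL ι A u)⁻¹) := by
  obtain ⟨L, hL, hL', rfl⟩ := hg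
  refine ⟨L.map (MulAut.conj (diagGL ι A u)), by simpa using hL, fun x hx => ?_, ?_⟩
  · obtain ⟨y, hy, rfl⟩ := List.mem_map.1 hx
    obtain ⟨i, j, hij, a, rfl⟩ := hL' y hy
    exact ⟨i, j, hij, _, diagGL_mul_elementaryGL_mul_inv u hij a⟩
  · rw [← map_list_prod, MulAut.conj_apply]

theorem val_elementaryGL_mul_elementaryGL {i j : ι} (hij : i ≠ j) (a b : A) :
    (elementaryGL i j hij a * elementaryGL j i hij.symm b).val =
      1 + single i j a + single j i b + single i i (a * b) := by
  simp [elementaryGL, mul_add, add_mul, add_assoc, add_left_comm]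

theorem one_add_singles_mul {i j : ι} (hij : i ≠ j) (a b c a' b' c' : A) :
    (1 + single i j a + single j i b + single i i c : Matrix ι ι A) *
      (1 + single i j a' + single j i b' + single i i c') =
    1 + single i j (a + a' + c * a') + single j i (b + b' + b * c') +
      single i i (c + c' + a * b' + c * c') + single j j (b * a') := by
  simp only [mul_add, add_mul, mul_one, one_mul, Matrix.single_mul_single_same,
    Matrix.single_mul_single_of_ne _ _ _ _ hij, Matrix.single_mul_single_of_ne _ _ _ _ hij.symm,
    Matrix.single_add]
  abel

/-- Whitehead's lemma: `diag(u, u⁻¹)` is a product of four elementary matrices. -/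
theorem hasWidth_mulSingle_mul_mulSingle_inv {i j : ι} (hij : i ≠ j) (u : Aˣ) :
    HasWidth 4 (diagGL ι A (Pi.mulSingle i u * Pi.mulSingle j u⁻¹)) := by
  have key : diagGL ι A (Pi.mulSingle i u * Pi.mulSingle j u⁻¹) =
      (elementaryGL i j hij (1 - u.val) * elementaryGL j i hij.symm (-1)) *
      (elementaryGL i j hij (1 - u⁻¹.val) * elementaryGL j i hij.symm u.val) := by
    ext1
    rw [Units.val_mul (elementaryGL _ _ _ _ * _), val_elementaryGL_mul_elementaryGL,
      val_elementaryGL_mul_elementaryGL, one_add_singles_mul hij, val_diagGL]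
    have h₁ : 1 - u.val + (1 - u⁻¹.val) + (1 - u.val) * -1 * (1 - u⁻¹.val) = 0 := by
      simp [mul_sub, sub_mul]
    have h₂ : -1 + u.val + -1 * ((1 - u⁻¹.val) * u.val) = 0 := by
      simp [sub_mul]
    have h₃ : (1 - u.val) * -1 + (1 - u⁻¹.val) * u.val + (1 - u.val) * u.val +
        (1 - u.val) * -1 * ((1 - u⁻¹.val) * u.val) = u.val - 1 := by
      simp only [sub_mul, mul_sub, mul_neg, mul_one, one_mul, neg_mul, Units.inv_mul]
      abel
    have h₄ : -1 * (1 - u⁻¹.val) = u⁻¹.val - 1 := by simp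
    rw [h₁, h₂, h₃, h₄, single_zero, single_zero, add_zero, add_zero]
    ext k l
    by_cases hkl : k = l
    · subst hkl
      by_cases hi : k = i
      · subst hi; simp [hij, hij.symm]
      · by_cases hj : k = j
        · subst hj; simp [hi, hij]
        · simp [hi, hj, Ne.symm hi, Ne.symm hj, Pi.mulSingle_apply]
    · rw [diagonal_apply_ne _ hkl, Matrix.add_apply, Matrix.add_apply, one_apply_ne hkl,
        single_apply, single_apply, if_neg (by rintro ⟨rfl, rfl⟩; exact hkl rfl),
        if_neg (by rintro ⟨rfl, rfl⟩; exact hkl rfl), add_zero, add_zero]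
  rw [key]
  exact ((hasWidth_elementaryGL _ _).mul (hasWidth_elementaryGL _ _)).mul
    ((hasWidth_elementaryGL _ _).mul (hasWidth_elementaryGL _ _))

/-- `diag(X Y X⁻¹ Y⁻¹, 1)` is the product of `diag(X, X⁻¹)` and of a conjugate of its inverse by
`diag(Y, 1)`. -/
theorem hasWidth_mulSingle_commutator [Nontrivial ι] (i : ι) (X Y : Aˣ) :
    HasWidth 8 (diagGL ι A (Pi.mulSingle i (X * Y * X⁻¹ * Y⁻¹))) := by
  obtain ⟨j, hji⟩ := exists_ne i
  have h₁ := hasWidth_mulSingle_mul_mulSingle_inv hji.symm X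
  have h₂ := (hasWidth_mulSingle_mul_mulSingle_inv hji.symm X⁻¹).conj_diagGL (Pi.mulSingle i Y)
  convert h₁.mul h₂
  rw [← map_inv, ← map_mul, ← map_mul, ← map_mul]
  congr 1
  ext1 k
  by_cases hi : k = i
  · subst hi
    simp [hji.symm, mul_assoc]
  · by_cases hj : k = j
    · subst hj; simp [hji]
    · simp [hi, hj]

/-- If `y x = 0`, then `diag(1 + x y, 1)` is the commutator of the elementary matrices with entries
`x` and `y`. -/
theorem hasWidth_mulSingle_one_add [Nontrivial ι] (i : ι) {u : Aˣ} {x y : A}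
    (hu : u.val = 1 + x * y) (h : y * x = 0) : HasWidth 4 (diagGL ι A (Pi.mulSingle i u)) := by
  obtain ⟨j, hji⟩ := exists_ne i
  have hij := hji.symm
  have key : diagGL ι A (Pi.mulSingle i u) =
      (elementaryGL i j hij x * elementaryGL j i hij.symm y) *
      (elementaryGL i j hij (-x) * elementaryGL j i hij.symm (-y)) := by
    ext1
    have h' : x * y * x = 0 := by rw [mul_assoc, h, mul_zero]
    have h'' : y * (x * y) = 0 := by rw [← mul_assoc, h, zero_mul]
    rw [Units.val_mul (elementaryGL _ _ _ _ * _), val_elementaryGL_mul_elementaryGL,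
      val_elementaryGL_mul_elementaryGL, one_add_singles_mul hij, val_diagGL]
    have h₁ : x + -x + x * y * -x = 0 := by simp [h']
    have h₂ : y + -y + y * (-x * -y) = 0 := by simp [h'']
    have h₃ : x * y + -x * -y + x * -y + x * y * (-x * -y) = x * y := by
      simp [mul_assoc, h'']
    have h₄ : y * -x = 0 := by simp [h]
    rw [h₁, h₂, h₃, h₄, single_zero, single_zero, single_zero, add_zero, add_zero, add_zero]
    ext k l
    by_cases hkl : k = l
    · subst hkl
      by_cases hi : k = i
      · subst hi; simp [hu]
      · simp [hi, Ne.symm hi, Pi.mulSingle_apply]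
    · rw [diagonal_apply_ne _ hkl, Matrix.add_apply, one_apply_ne hkl, single_apply,
        if_neg (by rintro ⟨rfl, rfl⟩; exact hkl rfl), add_zero]
  rw [key]
  exact ((hasWidth_elementaryGL _ _).mul (hasWidth_elementaryGL _ _)).mul
    ((hasWidth_elementaryGL _ _).mul (hasWidth_elementaryGL _ _))

/-- The unit is a product of a commutator and of two factors `1 + x y` with `y x = 0`; each of the
three becomes a bounded product of elementary matrices after stabilization. -/
def IsShort (T : Aˣ) : Prop :=
  ∃ (X Y u v : Aˣ) (x y z w : A), u.val = 1 + x * y ∧ y * x = 0 ∧ v.val = 1 + z * w ∧ w * z = 0 ∧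
    T = X * Y * X⁻¹ * Y⁻¹ * u * v

theorem IsShort.map {B : Type*} [Ring B] (e : A ≃+* B) {T : Aˣ} (hT : IsShort T) :
    IsShort (Units.mapEquiv (e : A ≃* B) T) := by
  obtain ⟨X, Y, u, v, x, y, z, w, hu, h, hv, h', rfl⟩ := hT
  refine ⟨Units.mapEquiv (e : A ≃* B) X, Units.mapEquiv (e : A ≃* B) Y,
    Units.mapEquiv (e : A ≃* B) u, Units.mapEquiv (e : A ≃* B) v, e x, e y, e z, e w,
    ?_, ?_, ?_, ?_, ?_⟩
  · simp [hu]
  · rw [← map_mul, h, map_zero]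
  · simp [hv]
  · rw [← map_mul, h', map_zero]
  · simp only [map_mul, map_inv]

theorem IsShort.hasWidth [Nontrivial ι] (i : ι) {T : Aˣ} (hT : IsShort T) :
    HasWidth 16 (diagGL ι A (Pi.mulSingle i T)) := by
  obtain ⟨X, Y, u, v, x, y, z, w, hu, h, hv, h', rfl⟩ := hT
  have e : ∀ a b : Aˣ, (Pi.mulSingle i (a * b) : ι → Aˣ) = Pi.mulSingle i a * Pi.mulSingle i b :=
    Pi.mulSingle_mul (f := fun _ : ι => Aˣ) i
  rw [e _ v, e _ u, map_mul, map_mul]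
  exact ((hasWidth_mulSingle_commutator i X Y).mul (hasWidth_mulSingle_one_add i hu h)).mul
    (hasWidth_mulSingle_one_add i hv h')

theorem hasWidth_diagGL {T : Fin 4 → Aˣ} (hT : ∀ i, IsShort (T i)) :
    HasWidth 64 (diagGL (Fin 4) A T) := by
  have : T = Pi.mulSingle 0 (T 0) * Pi.mulSingle 1 (T 1) * Pi.mulSingle 2 (T 2) *
      Pi.mulSingle 3 (T 3) := by
    ext1 i
    fin_cases i <;> simp
  rw [this, map_mul, map_mul, map_mul]
  exact ((((hT 0).hasWidth 0).mul ((hT 1).hasWidth 1)).mul ((hT 2).hasWidth 2)).mul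
    ((hT 3).hasWidth 3)

/-- The elementary factors are ordered so that all products of their off-diagonal parts vanish;
their entries are then those of the normalized matrix. -/
theorem hasWidth_of_upper {P : (Matrix (Fin 4) (Fin 4) A)ˣ} {T : Fin 4 → Aˣ}
    (hT : ∀ i, IsShort (T i)) (hd : ∀ i, P.val i i = T i) (hP : ∀ i j, j < i → P.val i j = 0) :
    HasWidth 70 P := by
  set x : Fin 4 → Fin 4 → A := fun i j => P.val i j * (T j)⁻¹.val with hx
  have key : P = elementaryGL 0 3 (by decide) (x 0 3) * elementaryGL 1 3 (by decide) (x 1 3) *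
      elementaryGL 2 3 (by decide) (x 2 3) * elementaryGL 0 2 (by decide) (x 0 2) *
      elementaryGL 1 2 (by decide) (x 1 2) * elementaryGL 0 1 (by decide) (x 0 1) *
      diagGL (Fin 4) A T := by
    rw [← mul_inv_eq_iff_eq_mul, ← map_inv]
    ext1
    rw [Units.val_mul, val_diagGL]
    simp only [Units.val_mul, elementaryGL, mul_add, add_mul, mul_one, one_mul]
    simp only [single_mul_single_of_ne, ne_eq, Fin.reduceEq, not_false_eq_true, add_zero, zero_mul]
    ext i j
    rw [mul_diagonal]
    fin_cases i <;> fin_cases j <;> simp [hx, hd, hP]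
  rw [key]
  exact ((((((hasWidth_elementaryGL _ _).mul (hasWidth_elementaryGL _ _)).mul
    (hasWidth_elementaryGL _ _)).mul (hasWidth_elementaryGL _ _)).mul
    (hasWidth_elementaryGL _ _)).mul (hasWidth_elementaryGL _ _)).mul (hasWidth_diagGL hT)

theorem hasWidth_of_lower {P : (Matrix (Fin 4) (Fin 4) A)ˣ} {T : Fin 4 → Aˣ}
    (hT : ∀ i, IsShort (T i)) (hd : ∀ i, P.val i i = T i) (hP : ∀ i j, i < j → P.val i j = 0) :
    HasWidth 70 P := by
  set x : Fin 4 → Fin 4 → A := fun i j => P.val i j * (T j)⁻¹.val with hx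
  have key : P = elementaryGL 1 0 (by decide) (x 1 0) * elementaryGL 2 0 (by decide) (x 2 0) *
      elementaryGL 2 1 (by decide) (x 2 1) * elementaryGL 3 0 (by decide) (x 3 0) *
      elementaryGL 3 1 (by decide) (x 3 1) * elementaryGL 3 2 (by decide) (x 3 2) *
      diagGL (Fin 4) A T := by
    rw [← mul_inv_eq_iff_eq_mul, ← map_inv]
    ext1
    rw [Units.val_mul, val_diagGL]
    simp only [Units.val_mul, elementaryGL, mul_add, add_mul, mul_one, one_mul]
    simp only [single_mul_single_of_ne, ne_eq, Fin.reduceEq, not_false_eq_true, add_zero, zero_mul]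
    ext i j
    rw [mul_diagonal]
    fin_cases i <;> fin_cases j <;> simp [hx, hd, hP]
  rw [key]
  exact ((((((hasWidth_elementaryGL _ _).mul (hasWidth_elementaryGL _ _)).mul
    (hasWidth_elementaryGL _ _)).mul (hasWidth_elementaryGL _ _)).mul
    (hasWidth_elementaryGL _ _)).mul (hasWidth_elementaryGL _ _)).mul (hasWidth_diagGL hT)

end Width

/-! ### Unitriangular matrices as commutators -/

section Commutator

variable {R : Type*} [Ring R] {m : ℕ}

theorem UpperUni.mul {M N : Matrix (Fin m) (Fin m) R} (hM : UpperUni M) (hN : UpperUni N) :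
    UpperUni (M * N) := by
  refine ⟨fun i => ?_, fun i j hij => ?_⟩
  · rw [Matrix.mul_apply, Finset.sum_eq_single i, hM.1, hN.1, one_mul]
    · intro k _ hk
      rcases lt_or_gt_of_ne hk with h | h
      · rw [hM.2 _ _ h, zero_mul]
      · rw [hN.2 _ _ h, mul_zero]
    · simp
  · rw [Matrix.mul_apply]
    refine Finset.sum_eq_zero fun k _ => ?_
    rcases lt_or_ge k i with h | h
    · rw [hM.2 _ _ h, zero_mul]
    · rw [hN.2 _ _ (hij.trans_le h), mul_zero]

/-- The superdiagonals of unitriangular matrices add up. -/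
theorem UpperUni.mul_apply_succ {M N : Matrix (Fin m) (Fin m) R} (hM : UpperUni M)
    (hN : UpperUni N) {i j : Fin m} (hij : j.val = i.val + 1) :
    (M * N) i j = M i j + N i j := by
  rw [Matrix.mul_apply, Finset.sum_eq_add i j, hM.1, hN.1, one_mul, mul_one, add_comm]
  · rintro rfl; omega
  · rintro k - ⟨hi, hj⟩
    rcases lt_or_gt_of_ne hi with h | h
    · rw [hM.2 _ _ h, zero_mul]
    · rw [hN.2 _ _ (by rw [Fin.lt_def] at h ⊢; have := Fin.val_ne_of_ne hj; omega), mul_zero]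
  · simp
  · simp

/-- The unipotent Jordan block. -/
def jordan (m : ℕ) (R : Type*) [Ring R] : Matrix (Fin m) (Fin m) R :=
  1 + Matrix.of fun i j => if j.val = i.val + 1 then 1 else 0

theorem upperUni_jordan : UpperUni (jordan m R) := by
  refine ⟨fun i => by simp [jordan], fun i j h => ?_⟩
  have : ¬ j.val = i.val + 1 := by rw [Fin.lt_def] at h; omega
  simp [jordan, this, one_apply_ne h.ne']

theorem jordan_apply_succ {i j : Fin m} (hij : j.val = i.val + 1) : jordan m R i j = 1 := by
  have : i ≠ j := by rintro rfl; omega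
  simp [jordan, hij, one_apply_ne this]

/-- The first possibly nonzero diagonal of `M ^ k`, for `M` strictly upper triangular with
superdiagonal entries `1`. -/
theorem pow_apply_of_superdiagonal {M : Matrix (Fin m) (Fin m) R}
    (h0 : ∀ i j : Fin m, j.val < i.val + 1 → M i j = 0)
    (h1 : ∀ i j : Fin m, j.val = i.val + 1 → M i j = 1) (k : ℕ) (i j : Fin m) :
    (j.val < i.val + k → (M ^ k) i j = 0) ∧ (j.val = i.val + k → (M ^ k) i j = 1) := by
  induction k generalizing i with
  | zero =>
    refine ⟨fun h => ?_, fun h => ?_⟩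
    · rw [pow_zero, one_apply_ne]; rintro rfl; omega
    · obtain rfl : i = j := Fin.ext h.symm
      rw [pow_zero, one_apply_eq]
  | succ k ih =>
    rw [pow_succ', Matrix.mul_apply]
    refine ⟨fun h => Finset.sum_eq_zero fun l _ => ?_, fun h => ?_⟩
    · rcases lt_or_ge l.val (i.val + 1) with hl | hl
      · rw [h0 _ _ hl, zero_mul]
      · rw [(ih l).1 (by omega), mul_zero]
    · have hi : i.val + 1 < m := by have := j.2; omega
      rw [Finset.sum_eq_single ⟨i.val + 1, hi⟩, h1 _ _ rfl, one_mul]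
      · exact (ih _).2 (by simp only []; omega)
      · intro l _ hl
        rcases lt_or_gt_of_ne (Fin.val_ne_of_ne hl) with hl | hl
        · rw [h0 _ _ hl, zero_mul]
        · rw [(ih l).1 (by simp only [] at hl; omega), mul_zero]
      · simp

/-- An upper unitriangular matrix with superdiagonal entries `1` is similar to a Jordan block: the
vectors `Mᵏ e`, where `M = A - 1` and `e` is the last basis vector, form a basis. -/
theorem UpperUni.exists_mul_eq_mul_jordan {A : Matrix (Fin (m + 1)) (Fin (m + 1)) R}
    (hA : UpperUni A) (hA1 : ∀ i j : Fin (m + 1), j.val = i.val + 1 → A i j = 1) :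
    ∃ X : Matrix (Fin (m + 1)) (Fin (m + 1)) R, UpperUni X ∧ A * X = X * jordan (m + 1) R := by
  obtain ⟨M, rfl⟩ : ∃ M, A = 1 + M := ⟨A - 1, by abel⟩
  have h0 : ∀ i j : Fin (m + 1), j.val < i.val + 1 → M i j = 0 := by
    intro i j h
    rcases (Nat.lt_succ_iff.1 h).lt_or_eq with h | h
    · have := hA.2 i j h
      have hne : i ≠ j := by rintro rfl; omega
      rwa [Matrix.add_apply, one_apply_ne hne, zero_add] at this
    · obtain rfl : j = i := Fin.ext h
      simpa using hA.1 j
  have h1 : ∀ i j : Fin (m + 1), j.val = i.val + 1 → M i j = 1 := by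
    intro i j h
    have hne : i ≠ j := by rintro rfl; omega
    simpa [one_apply_ne hne] using hA1 i j h
  have hpow := pow_apply_of_superdiagonal h0 h1
  refine ⟨Matrix.of fun i j => (M ^ (m - j.val)) i (Fin.last m), ⟨fun i => ?_, fun i j h => ?_⟩, ?_⟩
  · exact (hpow _ _ _).2 (by rw [Fin.val_last]; omega)
  · exact (hpow _ _ _).1 (by rw [Fin.val_last]; rw [Fin.lt_def] at h; omega)
  · rw [jordan, Matrix.add_mul, Matrix.mul_add, Matrix.one_mul, Matrix.mul_one]
    congr 1
    ext i j
    have : (M * Matrix.of fun i (j : Fin (m + 1)) => (M ^ (m - j.val)) i (Fin.last m)) i j =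
        (M ^ (m - j.val + 1)) i (Fin.last m) := by
      rw [pow_succ', Matrix.mul_apply, Matrix.mul_apply]; rfl
    rw [this, Matrix.mul_apply]
    obtain h | ⟨k, hk⟩ : j.val = 0 ∨ ∃ k, j.val = k + 1 :=
      (Nat.eq_zero_or_pos _).imp_right fun h => ⟨j.val - 1, by omega⟩
    · rw [(hpow _ _ _).1 (by rw [Fin.val_last]; omega)]
      refine (Finset.sum_eq_zero fun l _ => ?_).symm
      simp [h]
    · have hkm : k < m + 1 := by have := j.2; omega
      rw [Finset.sum_eq_single ⟨k, hkm⟩]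
      · have : m - k = m - j.val + 1 := by have := j.2; omega
        simp [hk, this]
      · intro l _ hl
        have : ¬ j.val = l.val + 1 := fun h => hl (Fin.ext (by simp only []; omega))
        simp [this]
      · simp

/-- An upper unitriangular matrix becomes similar to a Jordan block `J` after multiplication by
`J` and by two bidiagonal matrices, which remove the superdiagonal; these involve the even and the
odd rows, respectively. -/
theorem UpperUni.isShort {T : (Matrix (Fin (m + 1)) (Fin (m + 1)) R)ˣ} (hT : UpperUni T.val) :
    IsShort T := by
  set x : ℕ → Matrix (Fin (m + 1)) (Fin (m + 1)) R := fun b => Matrix.of fun i j =>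
    if j.val = i.val + 1 ∧ i.val % 2 = b then T.val i j else 0 with hx
  set y : ℕ → Matrix (Fin (m + 1)) (Fin (m + 1)) R := fun b =>
    diagonal fun i => if i.val % 2 = b then 0 else 1 with hy
  have hyx : ∀ b, y b * x b = 0 := by
    intro b
    ext i j
    by_cases h : i.val % 2 = b <;> simp [hx, hy, h]
  -- A superdiagonal entry in a row of parity `b` lies in a column of the other parity.
  have hxy : ∀ b, x b * y b = x b := by
    intro b
    ext i j
    by_cases h : j.val = i.val + 1 ∧ i.val % 2 = b
    · have : ¬ (i.val + 1) % 2 = b := by omega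
      simp [hx, hy, h, this]
    · simp [hx, hy, h]
  set B : ℕ → (Matrix (Fin (m + 1)) (Fin (m + 1)) R)ˣ := fun b => oneAddGL (x b) (y b) (hyx b)
  have hBinv : ∀ b, (B b)⁻¹.val = 1 - x b := by
    intro b
    have : (B b)⁻¹.val = 1 - x b * y b := rfl
    rw [this, hxy]
  have hBuni : ∀ b, UpperUni (B b)⁻¹.val := by
    intro b
    rw [hBinv]
    refine ⟨fun i => by simp [hx], fun i j h => ?_⟩
    have h' : ¬ j.val = i.val + 1 := by rw [Fin.lt_def] at h; omega
    simp [hx, h', one_apply_ne h.ne']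
  obtain ⟨J, -, hJ⟩ := (upperUni_jordan (m := m + 1) (R := R)).exists_mem_EL
  have hJuni : UpperUni J.val := hJ ▸ upperUni_jordan
  obtain ⟨X, hX, hAX⟩ := UpperUni.exists_mul_eq_mul_jordan (A := (T * (B 1)⁻¹ * (B 0)⁻¹ * J).val)
    (((hT.mul (hBuni 1)).mul (hBuni 0)).mul hJuni) (by
      intro i j hij
      have hne : i ≠ j := by rintro rfl; omega
      simp only [Units.val_mul]
      rw [((hT.mul (hBuni 1)).mul (hBuni 0)).mul_apply_succ hJuni hij,
        (hT.mul (hBuni 1)).mul_apply_succ (hBuni 0) hij,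
        hT.mul_apply_succ (hBuni 1) hij, hBinv, hBinv, hJ, jordan_apply_succ hij]
      rcases Nat.mod_two_eq_zero_or_one i.val with h | h <;> simp [hx, hij, h, hne])
  obtain ⟨X, -, rfl⟩ := hX.exists_mem_EL
  have hconj : T * (B 1)⁻¹ * (B 0)⁻¹ * J * X = X * J := by
    ext1
    rw [Units.val_mul, hAX, Units.val_mul, hJ]
  refine ⟨X, J, B 0, B 1, x 0, y 0, x 1, y 1, rfl, hyx 0, rfl, hyx 1, ?_⟩
  rw [← hconj]
  group

/-- Reversing the order of the basis exchanges upper and lower triangular matrices. -/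
theorem LowerUni.isShort {T : (Matrix (Fin (m + 1)) (Fin (m + 1)) R)ˣ} (hT : LowerUni T.val) :
    IsShort T := by
  have h : UpperUni (reindexGL Fin.revPerm T).val :=
    ⟨fun i => hT.1 _, fun i j hij => hT.2 _ _ (Fin.rev_lt_rev.2 hij)⟩
  have := h.isShort.map (Matrix.reindexRingEquiv R Fin.revPerm.symm)
  convert this
  ext1
  ext i j
  simp [val_reindexGL]

end Commutator

/-! ### Unitriangular matrices as products of elementary block matrices -/

section BlockWidth

variable {R : Type*} [Ring R]

/-- The identification of block matrices with matrices, for invertible matrices. -/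
def blockGL (b n : ℕ) (R : Type*) [Ring R] :
    (Matrix (Fin b) (Fin b) (Matrix (Fin n) (Fin n) R))ˣ ≃*
      (Matrix (Fin (b * n)) (Fin (b * n)) R)ˣ :=
  Units.mapEquiv (blockEquiv b n R : _ ≃* _)

theorem finProdFinEquiv_lt_left {b n : ℕ} {i j : Fin b} (h : i < j) (k l : Fin n) :
    finProdFinEquiv (i, k) < finProdFinEquiv (j, l) := by
  rw [Fin.lt_def] at h ⊢
  rw [finProdFinEquiv_apply_val, finProdFinEquiv_apply_val]
  have : n * (i.val + 1) ≤ n * j.val := Nat.mul_le_mul_left _ h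
  rw [Nat.mul_succ] at this
  have := k.2
  simp only
  omega

theorem finProdFinEquiv_lt_right {b n : ℕ} (i : Fin b) {k l : Fin n} (h : k < l) :
    finProdFinEquiv (i, k) < finProdFinEquiv (i, l) := by
  rw [Fin.lt_def] at h ⊢
  rw [finProdFinEquiv_apply_val, finProdFinEquiv_apply_val]
  simpa using h

theorem UpperUni.hasWidth {n : ℕ} {g : (Matrix (Fin (4 * (n + 1))) (Fin (4 * (n + 1))) R)ˣ}
    (hg : UpperUni g.val) : HasWidth 70 ((blockGL 4 (n + 1) R).symm g) := by
  have hdiag : ∀ i, UpperUni (((blockGL 4 (n + 1) R).symm g).val i i) := fun i =>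
    ⟨fun k => hg.1 _, fun k l h => hg.2 _ _ (finProdFinEquiv_lt_right i h)⟩
  choose T _ hT using fun i => (hdiag i).exists_mem_EL
  refine hasWidth_of_upper (T := T) (fun i => UpperUni.isShort ?_) (fun i => (hT i).symm) ?_
  · rw [hT]; exact hdiag i
  · intro i j hij
    ext k l
    exact hg.2 _ _ (finProdFinEquiv_lt_left hij l k)

theorem LowerUni.hasWidth {n : ℕ} {g : (Matrix (Fin (4 * (n + 1))) (Fin (4 * (n + 1))) R)ˣ}
    (hg : LowerUni g.val) : HasWidth 70 ((blockGL 4 (n + 1) R).symm g) := by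
  have hdiag : ∀ i, LowerUni (((blockGL 4 (n + 1) R).symm g).val i i) := fun i =>
    ⟨fun k => hg.1 _, fun k l h => hg.2 _ _ (finProdFinEquiv_lt_right i h)⟩
  choose T _ hT using fun i => (hdiag i).exists_mem_EL
  refine hasWidth_of_lower (T := T) (fun i => LowerUni.isShort ?_) (fun i => (hT i).symm) ?_
  · rw [hT]; exact hdiag i
  · intro i j hij
    ext k l
    exact hg.2 _ _ (finProdFinEquiv_lt_left hij k l)

end BlockWidth

end BlockElementary

theorem mainTheorem5 {R : Type*} [Ring R] (r d n : ℕ)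
    (hr : stableRange R = (r : ℕ∞)) (hrd : r < d) (hdn : d ≤ n)
    (g : (Matrix (Fin (4 * n)) (Fin (4 * n)) R)ˣ) (hg : g ∈ EL (4 * n) R) :
    ∃ (L : List (Matrix (Fin 4) (Fin 4) (Matrix (Fin n) (Fin n) R))ˣ)
      (s : (Matrix (Fin d) (Fin d) R)ˣ),
      L.length ≤ 340 ∧
      (∀ x ∈ L, x ∈ elementaryMatrices (Fin 4) (Matrix (Fin n) (Fin n) R)) ∧
      s ∈ EL d R ∧
      g.val = blockEquiv 4 n R L.prod.val *
        cornerEmbed (hdn.trans (Nat.le_mul_of_pos_left n four_pos)) s.val := by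
  obtain ⟨n, rfl⟩ : ∃ k, n = k + 1 := ⟨n - 1, by omega⟩
  obtain ⟨A, B, C, D, s, hs, hA, hB, hC, hD, hg'⟩ :=
    BlockElementary.exists_eq_mul_cornerEmbed
      (BlockElementary.leftStableRangeLE_of_stableRange_eq hr) hrd
      (hdn.trans (Nat.le_mul_of_pos_left (n + 1) four_pos)) g hg
  obtain ⟨L, hL, hL', hLprod⟩ := ((hA.hasWidth.mul hB.hasWidth).mul hC.hasWidth).mul hD.hasWidth
  refine ⟨L, s, hL.trans (by norm_num), hL', hs, ?_⟩
  rw [← map_mul, ← map_mul, ← map_mul, MulEquiv.eq_symm_apply] at hLprod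
  rw [hg', ← hLprod]
  rfl
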